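/- Let $\mathcal C_n=\{x\in\mathbb R^n: 0\le x_i\le 1 \text{ for all } i\}$ be the standard $n$-cube, $n\ge 1$. Definitions. For a full-dimensional convex polytope $\mathcal P\subset\mathbb R^n$, $\mathrm{vis}(\mathcal P)$ is the set of affine spans of its facets. For a finite arrangement $\mathcal A$ of affine hyperplanes and a point $p$ on none of them, $\mathrm{vo}(\mathcal A,p)$ is the set of hyperplanes consisting of $\mathrm{aff}(\{p\}\cup(H\cap H'))$ for non-parallel $H,H'\in\mathcal A$, and of the hyperplane through $p$ parallel to $H$ and $H'$ for distinct parallel $H,H'\in\mathcal A$. The characteristic polynomial of an arrangement $\mathcal B$ in $\mathbb R^n$ is $\chi_{\mathcal B}(q)=\sum_X\mu(\mathbb R^n,X)\,q^{\dim X}$, where $X$ ranges over the poset of nonempty intersections of members of $\mathcal B$ (including $\mathbb R^n$), ordered by reverse inclusion, and $\mu$ is its Möbius function. A line shelling of $\mathcal P$ through an interior point $p$ is an ordering of the facets obtained from a directed line through $p$ that meets the affine spans of the facets in pairwise distinct points and is parallel to none of them: the facets are listed in the order in which their affine spans are crossed when one starts at $p$, moves along the line in its direction to infinity, and returns to $p$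 from the opposite side. A line shelling of $\mathcal P$ is a line shelling through some interior point. A shelling of a $d$-polytope, $d\ge1$, is an ordering $F_1,\dots,F_s$ of its facets that is arbitrary if $d=1$ and, if $d\ge 2$, is such that for every $j$ the facet $F_j$ has a shelling $G_1,\dots,G_t$ with $F_j\cap(F_1\cup\dots\cup F_{j-1})=G_1\cup\dots\cup G_r$ for some $0\le r\le t$, this intersection being nonempty when $j>1$. Theorem. (a) For every $n\ge1$ let $p=(\frac12,\dots,\frac12)$ be the center of $\mathcal C_n$. Then $\mathrm{vo}(\mathrm{vis}(\mathcal C_n),p)$ is the translate by $p$ of the type $B_n$ Coxeter arrangement $\{x_i=0\}$ $(1\le i\le n)$, $\{x_i=x_j\}$, $\{x_i=-x_j\}$ $(1\le i<j\le n)$; its characteristic polynomial is $$\chi_{\mathrm{vo}(\mathrm{vis}(\mathcal C_n),p)}(q)=(q-1)(q-3)\cdots(q-(2n-1));$$ and the number of line shellings of $\mathcal C_n$ through $p$ is $2^n\,n!$. (b) For every $n\ge 1$ the total number of line shellings of $\mathcal C_n$ is $2^n\,(n!)^2$. (c) Let $f(n)$ be the total number of shellings of $\mathcal C_n$. Then,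 as formal power series, $$\sum_{n\ge1}f(n)\frac{x^n}{n!}=1-\frac1{\sum_{n\ge0}(2n)!\,\frac{x^n}{n!}}.$$ (d) For every $n\ge1$, every shelling of $\mathcal C_n$ can be realized as a line shelling of a polytope combinatorially equivalent to $\mathcal C_n$: for every shelling $F_1,\dots,F_{2n}$ of $\mathcal C_n$ there are a polytope $\mathcal Q\subset\mathbb R^n$ and an isomorphism $e$ from the face lattice of $\mathcal C_n$ to that of $\mathcal Q$ such that $e(F_1),\dots,e(F_{2n})$ is a line shelling of $\mathcal Q$. -/

import Mathlib

open Polynomial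
open scoped Nat

noncomputable section

section Polytopes

variable {E : Type*} [NormedAddCommGroup E] [NormedSpace ℝ E]

/-- A convex polytope: the convex hull of finitely many points. -/
def IsPolytope (P : Set E) : Prop := ∃ s : Finset E, P = convexHull ℝ (s : Set E)

/-- The dimension of (the affine span of) a nonempty set. -/
def affDim (P : Set E) : ℕ := Module.finrank ℝ (vectorSpan ℝ P)

/-- The faces of `P` (including `∅` and `P`), ordered by inclusion. The nonempty ones are the sets
of points of `P` at which some linear functional attains its maximum over `P`. -/
abbrev Face (P : Set E) : Type _ := {F : Set E // IsExposed ℝ P F}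

/-- The facets of `P`: the nonempty faces of dimension one less than `P`. -/
def IsFacet (P F : Set E) : Prop :=
  IsExposed ℝ P F ∧ F.Nonempty ∧ affDim F + 1 = affDim P

/-- `L` lists every facet of `P` exactly once. -/
def IsFacetOrdering (P : Set E) (L : List (Set E)) : Prop :=
  L.Nodup ∧ ∀ F, F ∈ L ↔ IsFacet P F

/-- The union of the first `k` members of a list of sets. -/
def prefixUnion (L : List (Set E)) (k : ℕ) : Set E := {x | ∃ F ∈ L.take k, x ∈ F}

/-- Shellings of the boundary complex of a `d`-dimensional polytope, by recursion on `d`.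
If the boundary complex has dimension at most `0`, every ordering of the facets is a shelling.
Otherwise the ordering `F₀, F₁, …` is a shelling if the boundary of every facet `Fⱼ` has a shelling
`G₀, G₁, …` such that the intersection of `Fⱼ` with the union of the earlier facets is the union of
an initial segment `G₀, …, Gᵣ₋₁`, and this intersection is nonempty for `0 < j`. -/
def IsShellingOfDim : ℕ → Set E → List (Set E) → Prop
  | 0, P, L => IsFacetOrdering P L
  | 1, P, L => IsFacetOrdering P L
  | d + 2, P, L => IsFacetOrdering P L ∧
      ∀ (j : ℕ) (hj : j < L.length),
        (0 < j → (L[j] ∩ prefixUnion L j).Nonempty) ∧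
        ∃ G : List (Set E), IsShellingOfDim (d + 1) L[j] G ∧
          ∃ r ≤ G.length, L[j] ∩ prefixUnion L j = prefixUnion G r

/-- `L` is a shelling of (the boundary complex of) the polytope `P`. -/
def IsShelling (P : Set E) (L : List (Set E)) : Prop := IsShellingOfDim (affDim P) P L

/-- The order in which the parameters `t ≠ 0` are met when one starts at `t = 0`, moves to `+∞`,
and comes back from `-∞` to `0`. -/
def MetBefore (s t : ℝ) : Prop := (0 < s ∧ t < 0) ∨ (0 < s * t ∧ s < t)

/-- `L` is the line shelling of `P` given by the line `t ↦ p + t • v` through the interior point `p`,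
directed by `v`: the line meets the affine span of each facet `F` in exactly one point
`p + τ F • v`, these points are distinct, and the facets are listed in the order in which their
affine spans are crossed when one leaves `p` in direction `v`, passes through infinity, and
returns to `p` from the opposite side. -/
def IsLineShellingAlong (P : Set E) (p v : E) (L : List (Set E)) : Prop :=
  p ∈ interior P ∧ IsFacetOrdering P L ∧
    ∃ τ : Set E → ℝ,
      (∀ F ∈ L, ∀ t : ℝ, p + t • v ∈ affineSpan ℝ F ↔ t = τ F) ∧
      L.Pairwise (fun F G => MetBefore (τ F) (τ G))

/-- The line shellings of `P` whose shelling line passes through `p`. -/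
def lineShellingsThrough (P : Set E) (p : E) : Set (List (Set E)) :=
  {L | ∃ v : E, IsLineShellingAlong P p v L}

/-- All line shellings of `P`. -/
def lineShellings (P : Set E) : Set (List (Set E)) :=
  {L | ∃ p : E, L ∈ lineShellingsThrough P p}

/-- All shellings of `P`. -/
def shellings (P : Set E) : Set (List (Set E)) := {L | IsShelling P L}

end Polytopes

section Arrangements

variable {E : Type*} [NormedAddCommGroup E] [NormedSpace ℝ E]

/-- The visibility arrangement: the affine spans of the facets of `P`. -/
def visArrangement (P : Set E) : Set (AffineSubspace ℝ E) :=
  {H | ∃ F, IsFacet P F ∧ H = affineSpan ℝ F}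

/-- The valid order arrangement of `A` with respect to `p`: the affine spans of `p` and `H ∩ H'` for
non-parallel `H, H'` in `A`, and the translates through `p` of distinct parallel `H, H'` in `A`. -/
def validOrderArrangement (A : Set (AffineSubspace ℝ E)) (p : E) : Set (AffineSubspace ℝ E) :=
  {K | ∃ H ∈ A, ∃ H' ∈ A, ¬ H.Parallel H' ∧
      K = affineSpan ℝ (insert p ((H : Set E) ∩ (H' : Set E)))} ∪
  {K | ∃ H ∈ A, ∃ H' ∈ A, H ≠ H' ∧ H.Parallel H' ∧ K = AffineSubspace.mk' p H.direction}

/-- The nonempty intersections of members of `A` (the whole space being the empty intersection). -/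
def intersectionSet (A : Set (AffineSubspace ℝ E)) : Set (AffineSubspace ℝ E) :=
  {X | X ≠ ⊥ ∧ ∃ B ⊆ A, X = sInf B}

theorem intersectionSet_finite {A : Set (AffineSubspace ℝ E)} (hA : A.Finite) :
    (intersectionSet A).Finite := by
  refine (hA.finite_subsets.image sInf).subset ?_
  rintro X ⟨-, B, hB, rfl⟩
  exact ⟨B, hB, rfl⟩

/-- The intersection poset of `A`, ordered by reverse inclusion. -/
abbrev IntersectionPoset (A : Set (AffineSubspace ℝ E)) : Type _ := (intersectionSet A)ᵒᵈ

/-- The whole space, as the least element of the intersection poset. -/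
def IntersectionPoset.whole (A : Set (AffineSubspace ℝ E)) : IntersectionPoset A :=
  OrderDual.toDual ⟨⊤, AffineSubspace.bot_ne_top ℝ E E |>.symm, ∅, Set.empty_subset _, by simp⟩

theorem intersectionPoset_finite {A : Set (AffineSubspace ℝ E)} (hA : A.Finite) :
    Finite (IntersectionPoset A) :=
  Finite.of_equiv _ (OrderDual.toDual (α := intersectionSet A))
    (h := (intersectionSet_finite hA).to_subtype)

/-- The polynomial `∑ μ(V, Y) q ^ dim Y`, where `Y` runs over the intersection poset of `A` and `μ` is
the Möbius function of this poset. -/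
def moebiusPoly (A : Set (AffineSubspace ℝ E)) [Fintype (IntersectionPoset A)]
    [LocallyFiniteOrder (IntersectionPoset A)] [DecidableEq (IntersectionPoset A)] : ℤ[X] :=
  ∑ Y : IntersectionPoset A,
    C (IncidenceAlgebra.mu ℤ (IntersectionPoset.whole A) Y) *
      X ^ Module.finrank ℝ (OrderDual.ofDual Y).1.direction

open Classical in
/-- The characteristic polynomial of a finite arrangement (and `0` for an infinite set `A`). -/
def arrangementCharPoly (A : Set (AffineSubspace ℝ E)) : ℤ[X] :=
  if hA : A.Finite then
    letI : Finite (IntersectionPoset A) := intersectionPoset_finite hA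
    letI : Fintype (IntersectionPoset A) := Fintype.ofFinite _
    letI : LocallyFiniteOrder (IntersectionPoset A) := Fintype.toLocallyFiniteOrder
    moebiusPoly A
  else 0

end Arrangements

section Cube

/-- The standard cube `0 ≤ xᵢ ≤ 1` in `ℝⁿ`. -/
def stdCube (n : ℕ) : Set (Fin n → ℝ) := {x | ∀ i, 0 ≤ x i ∧ x i ≤ 1}

/-- The center `(1/2, …, 1/2)` of the standard cube. -/
def cubeCenter (n : ℕ) : Fin n → ℝ := fun _ => 1 / 2

/-- The Coxeter arrangement of type `Bₙ`: the linear hyperplanes `xᵢ = 0`, and `xᵢ = xⱼ` and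
`xᵢ = -xⱼ` for `i < j`. -/
def coxeterB (n : ℕ) : Set (Submodule ℝ (Fin n → ℝ)) :=
  {W | ∃ i, ∀ x, x ∈ W ↔ x i = 0} ∪
  {W | ∃ i j, i < j ∧ ∀ x, x ∈ W ↔ x i = x j} ∪
  {W | ∃ i j, i < j ∧ ∀ x, x ∈ W ↔ x i = -x j}

/-- The number of all shellings of the standard `n`-cube. -/
def numCubeShellings (n : ℕ) : ℕ := (shellings (stdCube n)).ncard

/-- The ordering `L` of facets of `P` corresponds to the ordering `L'` of facets of `Q` under the
isomorphism `e` of face lattices. -/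
def Corresponds {E E' : Type*} [NormedAddCommGroup E] [NormedSpace ℝ E]
    [NormedAddCommGroup E'] [NormedSpace ℝ E'] {P : Set E} {Q : Set E'} (e : Face P ≃o Face Q)
    (L : List (Set E)) (L' : List (Set E')) : Prop :=
  List.Forall₂ (fun F G => ∃ hF : IsExposed ℝ P F, (e ⟨F, hF⟩ : Set E') = G) L L'

end Cube

end

/-! Facets of the cube are labelled by `Fin n × Bool`, and `CubeSystem` records any polytope cut out
by `2n` affine functionals with the facet-vertex incidences of a cube. Its nonempty faces correspond
to the sets of labels without opposite pairs, so all facet and shelling questions for such polytopes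
become questions about lists of labels.

Shellings. An ordering of the facets is a shelling exactly when no proper nonempty initial segment
is a union of opposite pairs (`Linked`, `CubeSystem.isShelling_iff`). Indeed, a facet meets the
earlier ones in the facets of a smaller cube, and a set of facets of that cube begins some shelling
iff it is empty, full, or contains a facet without its opposite. Cutting an arbitrary ordering after
its shortest nonempty initial segment closed under opposites gives `(2m)! = ∑ choose m k * f k *
(2(m-k))!`, which is the identity of generating functions (`card_enumLists_eq_sum`).

Line shellings of the cube. A line crosses exactly one facet hyperplane of each opposite pair before
infinity. Along coordinate `i` the two crossing parameters can be any positive and any negative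
number, independently of the other coordinates. Hence a line shelling is a choice of signs and two
orderings of the directions. At the center opposite crossings are negatives of each other, so the
second ordering is the reverse of the first.

Realization. Under polar duality a line shelling of a cube-like polytope becomes the listing of the
vertices of a cross-polytope by decreasing height. Such a cross-polytope with prescribed heights is
built by iterated bipyramids: a new direction can be added once some inner point has height strictly
between the two new heights, and linkedness says that such a direction is always available
(`HeightLinked.exists_strictlyBetween`).

Characteristic polynomial. Every flat of dimension `d` of the type B arrangement contains `(2m+1)^d`
points of the integer box `[-m,m]^n`. By Möbius inversion the polynomial at `2m+1` counts the box
points off all hyperplanes, namely those with nonzero coordinates of distinct absolute values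
(`eval_arrangementCharPoly`, `card_intBox_off_coxeterB`). -/

/-! ### Facet labels, opposite pairs and free directions -/

/-- The label of the facet opposite to the facet labelled `k`. -/
def opp {n : ℕ} (k : Fin n × Bool) : Fin n × Bool := (k.1, !k.2)

@[simp] theorem opp_opp {n : ℕ} (k : Fin n × Bool) : opp (opp k) = k := by simp [opp]

@[simp] theorem opp_fst {n : ℕ} (k : Fin n × Bool) : (opp k).1 = k.1 := rfl

theorem opp_ne {n : ℕ} (k : Fin n × Bool) : opp k ≠ k := by
  rcases k with ⟨i, b⟩; simp [opp]

theorem eq_or_eq_opp {n : ℕ} {k l : Fin n × Bool} (h : k.1 = l.1) : k = l ∨ k = opp l := by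
  rcases k with ⟨i, b⟩; rcases l with ⟨j, c⟩
  simp only at h; subst h
  cases b <;> cases c <;> simp [opp]

/-- A set of facet labels without opposite pairs. -/
def Consistent {n : ℕ} (T : Set (Fin n × Bool)) : Prop := ∀ k ∈ T, opp k ∉ T

theorem Consistent.exists_sign {n : ℕ} {T : Set (Fin n × Bool)} (h : Consistent T) :
    ∃ s : Fin n → Bool, ∀ k ∈ T, s k.1 = k.2 := by
  classical
  refine ⟨fun i => decide ((i, true) ∈ T), ?_⟩
  rintro ⟨i, b⟩ hk
  cases b
  · have := h _ hk
    simpa [opp] using this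
  · simpa using hk

/-- The directions in which no facet label of `T` points. -/
noncomputable def freeDir {n : ℕ} (T : Set (Fin n × Bool)) : Finset (Fin n) := by
  classical exact Finset.univ.filter fun i => ∀ b, (i, b) ∉ T

theorem mem_freeDir {n : ℕ} {T : Set (Fin n × Bool)} {i : Fin n} :
    i ∈ freeDir T ↔ ∀ b, (i, b) ∉ T := by
  simp [freeDir]

theorem Consistent.insert {n : ℕ} {T : Set (Fin n × Bool)} (h : Consistent T) {k : Fin n × Bool}
    (hk : k.1 ∈ freeDir T) : Consistent (insert k T) := by
  rw [mem_freeDir] at hk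
  rintro l (rfl | hl) (hl' | hl')
  · exact opp_ne _ hl'
  · exact hk _ hl'
  · exact hk (opp k).2 (by rw [← hl']; simpa using hl)
  · exact h l hl hl'

theorem consistent_empty {n : ℕ} : Consistent (∅ : Set (Fin n × Bool)) := fun _ h => h.elim

theorem freeDir_empty {n : ℕ} : freeDir (∅ : Set (Fin n × Bool)) = Finset.univ := by
  ext i; simp [mem_freeDir]

theorem freeDir_insert {n : ℕ} (T : Set (Fin n × Bool)) (k : Fin n × Bool) :
    freeDir (insert k T) = (freeDir T).erase k.1 := by
  ext i
  simp only [mem_freeDir, Set.mem_insert_iff, not_or, Finset.mem_erase]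
  constructor
  · intro h
    refine ⟨fun hi => ?_, fun b => (h b).2⟩
    exact (h k.2).1 (by rw [hi])
  · rintro ⟨h1, h2⟩ b
    exact ⟨fun hb => h1 (by rw [← hb]), h2 b⟩

/-! ### The face lattice of a polytope with the incidences of a cube -/

/-- A system of `2n` affine functionals on `ℝⁿ`, in `n` opposite pairs, with the incidences between
facets and vertices of an `n`-cube. -/
structure CubeSystem (n : ℕ) where
  /-- The functionals. -/
  g : Fin n × Bool → (Fin n → ℝ) →ᵃ[ℝ] ℝ
  /-- The vertices. -/
  v : (Fin n → Bool) → (Fin n → ℝ)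
  g_self : ∀ s i, g (i, s i) (v s) = 0
  g_not : ∀ s i, 0 < g (i, !s i) (v s)

namespace CubeSystem

variable {n : ℕ} (S : CubeSystem n)

/-- The face on which the functionals with labels in `T` vanish. -/
def face (T : Set (Fin n × Bool)) : Set (Fin n → ℝ) :=
  {x | (∀ k, 0 ≤ S.g k x) ∧ ∀ k ∈ T, S.g k x = 0}

theorem linear_sub (k : Fin n × Bool) (x y : Fin n → ℝ) :
    (S.g k).linear (x - y) = S.g k x - S.g k y := (S.g k).linearMap_vsub x y

theorem g_add (k : Fin n × Bool) (x u : Fin n → ℝ) :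
    S.g k (x + u) = S.g k x + (S.g k).linear u := by
  have := S.linear_sub k (x + u) x
  rw [add_sub_cancel_left] at this
  linarith

theorem g_combo (k : Fin n × Bool) (x y : Fin n → ℝ) {a b : ℝ} (h : a + b = 1) :
    S.g k (a • x + b • y) = a * S.g k x + b * S.g k y := by
  have := Convex.combo_affine_apply (f := S.g k) (x := x) (y := y) h
  simpa using this

theorem g_v_nonneg (k : Fin n × Bool) (s : Fin n → Bool) : 0 ≤ S.g k (S.v s) := by
  rcases k with ⟨i, b⟩
  by_cases h : s i = b
  · rw [← h, S.g_self]
  · have h : b = !s i := by revert h; cases b <;> cases s i <;> simp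
    rw [h]; exact (S.g_not s i).le

theorem g_v_eq_zero {k : Fin n × Bool} {s : Fin n → Bool} : S.g k (S.v s) = 0 ↔ s k.1 = k.2 := by
  rcases k with ⟨i, b⟩
  by_cases h : s i = b
  · simp only [h, iff_true]; rw [← h, S.g_self]
  · simp only [h, iff_false]
    have h : b = !s i := by revert h; cases b <;> cases s i <;> simp
    rw [h]; exact (S.g_not s i).ne'

theorem v_mem_face {T : Set (Fin n × Bool)} {s : Fin n → Bool} (h : ∀ k ∈ T, s k.1 = k.2) :
    S.v s ∈ S.face T := ⟨fun k => S.g_v_nonneg k s, fun k hk => S.g_v_eq_zero.2 (h k hk)⟩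

theorem face_mono {T T' : Set (Fin n × Bool)} (h : T ⊆ T') : S.face T' ⊆ S.face T :=
  fun _ hx => ⟨hx.1, fun k hk => hx.2 k (h hk)⟩

theorem face_inter (T T' : Set (Fin n × Bool)) : S.face T ∩ S.face T' = S.face (T ∪ T') := by
  ext x
  constructor
  · rintro ⟨h, h'⟩
    exact ⟨h.1, fun k hk => hk.elim (h.2 k) (h'.2 k)⟩
  · exact fun h => ⟨S.face_mono Set.subset_union_left h, S.face_mono Set.subset_union_right h⟩

theorem convex_face (T : Set (Fin n × Bool)) : Convex ℝ (S.face T) := by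
  intro x hx y hy a b ha hb hab
  refine ⟨fun k => ?_, fun k hk => ?_⟩
  · rw [S.g_combo k x y hab]
    have := hx.1 k; have := hy.1 k; positivity
  · rw [S.g_combo k x y hab, hx.2 k hk, hy.2 k hk]; simp

/-- Averaging: all functionals are nonnegative on `D`, so a midpoint keeps every positivity that
either endpoint has, and finitely many midpoints collect them all. The resulting point plays the
role of a relative interior point. -/
theorem exists_generic {D : Set (Fin n → ℝ)} (hD : Convex ℝ D) (hne : D.Nonempty)
    (hsub : D ⊆ S.face ∅) : ∃ x ∈ D, ∀ k, (∃ y ∈ D, 0 < S.g k y) → 0 < S.g k x := by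
  classical
  have key : ∀ U : Finset (Fin n × Bool),
      ∃ x ∈ D, ∀ k ∈ U, (∃ y ∈ D, 0 < S.g k y) → 0 < S.g k x := by
    intro U
    induction U using Finset.induction_on with
    | empty => obtain ⟨x, hx⟩ := hne; exact ⟨x, hx, by simp⟩
    | insert a U _ ih =>
      obtain ⟨x, hx, hxU⟩ := ih
      by_cases ha : ∃ y ∈ D, 0 < S.g a y
      · obtain ⟨y, hy, hya⟩ := ha
        have h2 : (1 / 2 : ℝ) + 1 / 2 = 1 := by norm_num
        refine ⟨(1 / 2 : ℝ) • x + (1 / 2 : ℝ) • y, hD hx hy (by norm_num) (by norm_num) h2, ?_⟩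
        intro k hk hky
        rw [S.g_combo k x y h2]
        have h0x := (hsub hx).1 k
        have h0y := (hsub hy).1 k
        rcases Finset.mem_insert.1 hk with rfl | hk
        · linarith
        · have := hxU k hk hky; linarith
      · refine ⟨x, hx, fun k hk hky => ?_⟩
        rcases Finset.mem_insert.1 hk with rfl | hk
        · exact absurd hky ha
        · exact hxU k hk hky
  obtain ⟨x, hx, h⟩ := key Finset.univ
  exact ⟨x, hx, fun k => h k (Finset.mem_univ k)⟩

theorem exists_generic_face {T : Set (Fin n × Bool)} (hT : Consistent T) :
    ∃ x ∈ S.face T, ∀ k, S.g k x = 0 ↔ k ∈ T := by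
  classical
  obtain ⟨s, hs⟩ := hT.exists_sign
  obtain ⟨x, hx, h⟩ := S.exists_generic (S.convex_face T) ⟨_, S.v_mem_face hs⟩
    (S.face_mono (Set.empty_subset T))
  refine ⟨x, hx, fun k => ⟨fun hk => ?_, hx.2 k⟩⟩
  by_contra hkT
  refine (h k ?_).ne' hk
  -- A vertex of the face off facet `k`: if `opp k ∈ T`, any vertex of the face will do; otherwise
  -- the direction of `k` is unconstrained and can be set opposite to `k`.
  refine ⟨S.v (if opp k ∈ T then s else Function.update s k.1 (!k.2)), S.v_mem_face ?_, ?_⟩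
  · intro l hl
    split_ifs with hk
    · exact hs l hl
    · have : l.1 ≠ k.1 := by
        intro hlk
        rcases eq_or_eq_opp hlk with rfl | rfl
        · exact hkT hl
        · exact hk hl
      rw [Function.update_of_ne this, hs l hl]
  · refine lt_of_le_of_ne (S.g_v_nonneg _ _) (Ne.symm ?_)
    rw [Ne, S.g_v_eq_zero]
    split_ifs with hk
    · have := hs _ hk
      simp only [opp] at this
      rw [this]; simp
    · simp

theorem face_subset_face_iff {T T' : Set (Fin n × Bool)} (hT : Consistent T) :
    S.face T ⊆ S.face T' ↔ T' ⊆ T := by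
  refine ⟨fun h k hk => ?_, fun h => S.face_mono h⟩
  obtain ⟨x, hx, hxT⟩ := S.exists_generic_face hT
  exact (hxT k).1 ((h hx).2 k hk)

theorem face_injOn : Set.InjOn S.face {T | Consistent T} := fun _ hT _ hT' h =>
  ((S.face_subset_face_iff hT').1 h.ge).antisymm ((S.face_subset_face_iff hT).1 h.le)

theorem face_nonempty {T : Set (Fin n × Bool)} (hT : Consistent T) : (S.face T).Nonempty :=
  let ⟨x, hx, _⟩ := S.exists_generic_face hT
  ⟨x, hx⟩

/-- The vertex adjacent to `v s` in direction `j`, relative to `v s`. -/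
def edge (s : Fin n → Bool) (j : Fin n) : Fin n → ℝ := S.v (Function.update s j (!s j)) - S.v s

theorem linear_edge (s : Fin n → Bool) (i j : Fin n) :
    (S.g (i, s i)).linear (S.edge s j) = if i = j then S.g (i, s i) (S.v (Function.update s i (!s i)))
      else 0 := by
  rw [edge, S.linear_sub, S.g_self, sub_zero]
  split_ifs with h
  · rw [h]
  · rw [S.g_v_eq_zero]; simp [h]

theorem pivot_pos (s : Fin n → Bool) (i : Fin n) :
    0 < S.g (i, s i) (S.v (Function.update s i (!s i))) := by
  refine lt_of_le_of_ne (S.g_v_nonneg _ _) (Ne.symm ?_)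
  rw [Ne, S.g_v_eq_zero]; simp

/-- The functionals vanishing at the vertex `v s` are, up to positive factors, dual to the edges
there: each is positive on its own edge and zero on the others. -/
theorem linearIndependent_edge (s : Fin n → Bool) : LinearIndependent ℝ (S.edge s) := by
  rw [Fintype.linearIndependent_iff]
  intro c hc i
  have := congrArg (S.g (i, s i)).linear hc
  simp only [map_sum, map_smul, S.linear_edge, smul_eq_mul, map_zero, mul_ite, mul_zero,
    Finset.sum_ite_eq, Finset.mem_univ, if_true] at this
  exact (mul_eq_zero.1 this).resolve_right (S.pivot_pos s i).ne'

theorem eq_sum_edge (s : Fin n → Bool) (u : Fin n → ℝ) :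
    u = ∑ j, ((S.g (j, s j)).linear u / S.g (j, s j) (S.v (Function.update s j (!s j)))) •
      S.edge s j := by
  have hspan := (S.linearIndependent_edge s).span_eq_top_of_card_eq_finrank' (by simp)
  have hu : u ∈ Submodule.span ℝ (Set.range (S.edge s)) := hspan ▸ Submodule.mem_top
  obtain ⟨c, rfl⟩ := (Submodule.mem_span_range_iff_exists_fun ℝ).1 hu
  refine Finset.sum_congr rfl fun j _ => ?_
  congr 1
  simp only [map_sum, map_smul, S.linear_edge, smul_eq_mul, mul_ite, mul_zero,
    Finset.sum_ite_eq, Finset.mem_univ, if_true]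
  rw [mul_div_cancel_right₀ _ (S.pivot_pos s j).ne']

/-- The argument of the simplex method. If `l` separates `x` from the vertices, take the vertex with
the largest `l`. No edge there increases `l`, and `x` minus the vertex is a nonnegative combination
of these edges, so `l` cannot be larger at `x`. -/
theorem face_empty_eq : S.face ∅ = convexHull ℝ (Set.range S.v) := by
  apply Set.Subset.antisymm
  · intro x hx
    by_contra hxc
    obtain ⟨l, u, hl, hux⟩ := geometric_hahn_banach_closed_point (convex_convexHull ℝ (Set.range S.v))
      ((Set.finite_range S.v).isCompact_convexHull ℝ).isClosed hxc
    obtain ⟨s, hs⟩ := Finite.exists_max fun s => l (S.v s)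
    have h1 : l (x - S.v s) ≤ 0 := by
      rw [S.eq_sum_edge s (x - S.v s), map_sum]
      refine Finset.sum_nonpos fun j _ => ?_
      rw [map_smul, smul_eq_mul]
      refine mul_nonpos_of_nonneg_of_nonpos (div_nonneg ?_ (S.pivot_pos s j).le) ?_
      · rw [S.linear_sub, S.g_self, sub_zero]; exact hx.1 _
      · rw [edge, map_sub]; linarith [hs (Function.update s j (!s j))]
    have h2 := hl (S.v s) (subset_convexHull ℝ _ ⟨s, rfl⟩)
    rw [map_sub] at h1
    linarith
  · refine convexHull_min ?_ (S.convex_face ∅)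
    rintro _ ⟨s, rfl⟩
    exact S.v_mem_face (by simp)

theorem isPolytope_face_empty : IsPolytope (S.face ∅) :=
  ⟨(Set.finite_range S.v).toFinset, by simpa using S.face_empty_eq⟩

/-- Opposite facets are disjoint: the sum of their functionals is positive at every vertex, hence on
the convex hull. -/
theorem g_opp_ne_zero {x : Fin n → ℝ} (hx : x ∈ S.face ∅) {k : Fin n × Bool} (hk : S.g k x = 0) :
    S.g (opp k) x ≠ 0 := by
  have hconv : Convex ℝ {x | 0 < (S.g k + S.g (opp k)) x} :=
    (convex_Ioi (0 : ℝ)).affine_preimage (S.g k + S.g (opp k))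
  have : x ∈ {x | 0 < (S.g k + S.g (opp k)) x} := by
    rw [S.face_empty_eq] at hx
    refine convexHull_min ?_ hconv hx
    rintro _ ⟨s, rfl⟩
    have h1 := S.g_v_nonneg k s
    have h2 := S.g_v_nonneg (opp k) s
    have h3 : S.g k (S.v s) ≠ 0 ∨ S.g (opp k) (S.v s) ≠ 0 := by
      rw [Ne, Ne, S.g_v_eq_zero, S.g_v_eq_zero, ← not_and_or]
      rintro ⟨h, h'⟩
      simp [opp, h] at h'
    simp only [Set.mem_ofPred_eq, AffineMap.coe_add, Pi.add_apply]
    rcases h3 with h3 | h3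
    · have := lt_of_le_of_ne h1 h3.symm; linarith
    · have := lt_of_le_of_ne h2 h3.symm; linarith
  intro h
  simp [hk, h] at this

theorem consistent_of_face_nonempty {T : Set (Fin n × Bool)} (h : (S.face T).Nonempty) :
    Consistent T := by
  obtain ⟨x, hx⟩ := h
  exact fun k hk hk' => S.g_opp_ne_zero (S.face_mono (Set.empty_subset T) hx) (hx.2 k hk) (hx.2 _ hk')

/-- The exposing functional is minus the sum of the functionals labelled by `T'`: a sum of
nonnegative terms is minimal, with value zero, exactly where all of them vanish. -/
theorem isExposed_face {T T' : Set (Fin n × Bool)} (h : T ⊆ T') :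
    IsExposed ℝ (S.face T) (S.face T') := by
  classical
  rintro ⟨z, hz⟩
  let l : (Fin n → ℝ) →ₗ[ℝ] ℝ := -∑ k, if k ∈ T' then (S.g k).linear else 0
  have hl : ∀ x, l x - l z = -∑ k, if k ∈ T' then S.g k x else 0 := by
    intro x
    rw [← map_sub]
    simp only [l, LinearMap.neg_apply, LinearMap.sum_apply, neg_inj]
    refine Finset.sum_congr rfl fun k _ => ?_
    split_ifs with hk
    · rw [S.linear_sub, hz.2 k hk, sub_zero]
    · rfl
  have hle : ∀ x ∈ S.face T, l x ≤ l z := by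
    intro x hx
    have : 0 ≤ ∑ k, if k ∈ T' then S.g k x else 0 :=
      Finset.sum_nonneg fun k _ => by split_ifs; exacts [hx.1 k, le_rfl]
    linarith [hl x]
  refine ⟨LinearMap.toContinuousLinearMap l, ?_⟩
  ext x
  simp only [LinearMap.coe_toContinuousLinearMap', Set.mem_ofPred_eq]
  constructor
  · intro hx
    refine ⟨S.face_mono h hx, fun y hy => ?_⟩
    have : ∑ k, (if k ∈ T' then S.g k x else 0) = 0 :=
      Finset.sum_eq_zero fun k _ => by split_ifs with hk; exacts [hx.2 k hk, rfl]
    linarith [hl x, hle y hy]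
  · rintro ⟨hx, hmax⟩
    refine ⟨hx.1, fun k hk => ?_⟩
    have h1 := hmax z (S.face_mono h hz)
    have h2 : ∑ k, (if k ∈ T' then S.g k x else 0) = 0 :=
      le_antisymm (by linarith [hl x])
        (Finset.sum_nonneg fun k _ => by split_ifs; exacts [hx.1 k, le_rfl])
    have := (Finset.sum_eq_zero_iff_of_nonneg fun k _ => by
      split_ifs; exacts [hx.1 k, le_rfl]).1 h2 k (Finset.mem_univ k)
    simpa [hk] using this

/-- The labels of the functionals vanishing on `F`. -/
def active (F : Set (Fin n → ℝ)) : Set (Fin n × Bool) := {k | ∀ x ∈ F, S.g k x = 0}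

/-- Let `x` be generic in `F` and let `y` satisfy all equations valid on `F`. The segment from `y`
to `x` can be prolonged slightly beyond `x` inside the polytope. As the exposing functional is
maximal at `x`, it cannot be smaller at `y`, so `y` lies in `F`. -/
theorem eq_face_active {T : Set (Fin n × Bool)} {F : Set (Fin n → ℝ)}
    (hF : IsExposed ℝ (S.face T) F) (hne : F.Nonempty) : F = S.face (S.active F) := by
  have hsub : F ⊆ S.face T := hF.subset
  have hsub' : F ⊆ S.face ∅ := hsub.trans (S.face_mono (Set.empty_subset T))
  have hT : T ⊆ S.active F := fun k hk x hx => (hsub hx).2 k hk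
  obtain ⟨x, hx, hgen⟩ := S.exists_generic (hF.convex (S.convex_face T)) hne hsub'
  refine Set.Subset.antisymm (fun y hy => ⟨(hsub' hy).1, fun k hk => hk y hy⟩) fun y hy => ?_
  obtain ⟨l, hl⟩ := hF hne
  have hev : ∀ k, k ∉ S.active F → ∀ᶠ t in nhdsWithin (0 : ℝ) (Set.Ioi 0),
      t * S.g k y < S.g k x := by
    intro k hk
    have hpos : 0 < S.g k x := by
      simp only [active, Set.mem_ofPred_eq, not_forall] at hk
      obtain ⟨z, hz, hkz⟩ := hk
      exact hgen k ⟨z, hz, lt_of_le_of_ne ((hsub' hz).1 k) (Ne.symm hkz)⟩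
    have : Filter.Tendsto (fun t : ℝ => t * S.g k y) (nhdsWithin 0 (Set.Ioi 0)) (nhds (0 * S.g k y)) :=
      ((continuous_id.mul continuous_const).tendsto 0).mono_left nhdsWithin_le_nhds
    rw [zero_mul] at this
    exact this.eventually_lt_const hpos
  have hev' : ∀ᶠ t in nhdsWithin (0 : ℝ) (Set.Ioi 0), ∀ k, k ∉ S.active F →
      t * S.g k y < S.g k x :=
    Filter.eventually_all.2 fun k => by
      by_cases hk : k ∈ S.active F
      · exact Filter.Eventually.of_forall fun _ h => absurd hk h
      · exact (hev k hk).mono fun _ h _ => h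
  obtain ⟨t, ht, ht0⟩ := (hev'.and self_mem_nhdsWithin).exists
  have ht0 : 0 < t := ht0
  have hgz : ∀ k, S.g k ((1 + t) • x + (-t) • y) = (1 + t) * S.g k x + (-t) * S.g k y :=
    fun k => S.g_combo k x y (by ring)
  have hz : (1 + t) • x + (-t) • y ∈ S.face T := by
    refine ⟨fun k => ?_, fun k hk => ?_⟩
    · rw [hgz]
      have h0 := (hsub' hx).1 k
      by_cases hk : k ∈ S.active F
      · rw [hk x hx, hy.2 k hk]; simp
      · have := ht k hk; nlinarith
    · rw [hgz, hT hk x hx, hy.2 k (hT hk)]; simp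
  rw [hl] at hx
  have h1 := hx.2 _ hz
  rw [map_add, map_smul, map_smul, smul_eq_mul, smul_eq_mul] at h1
  rw [hl]
  refine ⟨S.face_mono hT hy, fun w hw => (hx.2 w hw).trans ?_⟩
  nlinarith

theorem active_face {T : Set (Fin n × Bool)} (hT : Consistent T) : S.active (S.face T) = T := by
  obtain ⟨x, hx, h⟩ := S.exists_generic_face hT
  exact Set.Subset.antisymm (fun k hk => (h k).1 (hk x hx)) fun k hk y hy => hy.2 k hk

theorem isExposed_iff {T : Set (Fin n × Bool)} {F : Set (Fin n → ℝ)} (hne : F.Nonempty) :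
    IsExposed ℝ (S.face T) F ↔ ∃ T', T ⊆ T' ∧ F = S.face T' := by
  constructor
  · intro h
    exact ⟨S.active F, fun k hk x hx => (h.subset hx).2 k hk, S.eq_face_active h hne⟩
  · rintro ⟨T', hT, rfl⟩
    exact S.isExposed_face hT

theorem vectorSpan_face {T : Set (Fin n × Bool)} (s : Fin n → Bool) (hs : ∀ k ∈ T, s k.1 = k.2) :
    vectorSpan ℝ (S.face T) = Submodule.span ℝ (Set.range fun j : freeDir T => S.edge s j) := by
  apply le_antisymm
  · rw [vectorSpan_def, Submodule.span_le]
    rintro _ ⟨x, hx, y, hy, rfl⟩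
    change x - y ∈ _
    rw [S.eq_sum_edge s (x - y)]
    refine Submodule.sum_mem _ fun j _ => ?_
    by_cases hj : j ∈ freeDir T
    · exact Submodule.smul_mem _ _ (Submodule.subset_span ⟨⟨j, hj⟩, rfl⟩)
    · rw [mem_freeDir] at hj
      push Not at hj
      obtain ⟨b, hb⟩ := hj
      have := hs _ hb
      simp only at this
      rw [this, S.linear_sub, hx.2 _ hb, hy.2 _ hb]
      simp
  · rw [Submodule.span_le]
    rintro _ ⟨⟨j, hj⟩, rfl⟩
    rw [mem_freeDir] at hj
    refine vsub_mem_vectorSpan ℝ (S.v_mem_face fun k hk => ?_) (S.v_mem_face hs)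
    have : k.1 ≠ j := by
      rintro rfl
      exact hj k.2 hk
    rw [Function.update_of_ne this, hs k hk]

theorem affDim_face {T : Set (Fin n × Bool)} (hT : Consistent T) :
    affDim (S.face T) = (freeDir T).card := by
  obtain ⟨s, hs⟩ := hT.exists_sign
  rw [affDim, S.vectorSpan_face s hs, finrank_span_eq_card]
  · simp
  · exact (S.linearIndependent_edge s).comp _ Subtype.val_injective

/-- The dimension of a face is its number of free directions, so a facet fixes exactly one more
direction, and by consistency adds exactly one label. -/
theorem isFacet_iff {T : Set (Fin n × Bool)} (hT : Consistent T) {F : Set (Fin n → ℝ)} :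
    IsFacet (S.face T) F ↔ ∃ k : Fin n × Bool, k.1 ∈ freeDir T ∧ F = S.face (insert k T) := by
  constructor
  · rintro ⟨hexp, hne, hdim⟩
    obtain ⟨T', hTT', rfl⟩ := (S.isExposed_iff hne).1 hexp
    have hT' := S.consistent_of_face_nonempty hne
    rw [S.affDim_face hT', S.affDim_face hT] at hdim
    have hsub : freeDir T' ⊆ freeDir T := fun i hi =>
      mem_freeDir.2 fun b hb => mem_freeDir.1 hi b (hTT' hb)
    have hcard : (freeDir T \ freeDir T').card = 1 := by
      rw [Finset.card_sdiff_of_subset hsub]; omega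
    obtain ⟨i, hi⟩ := Finset.card_eq_one.1 hcard
    have hi' : i ∈ freeDir T \ freeDir T' := by simp [hi]
    obtain ⟨hiT, hiT'⟩ := Finset.mem_sdiff.1 hi'
    have : ∃ b, (i, b) ∈ T' := by
      by_contra h
      exact hiT' (mem_freeDir.2 fun b hb => h ⟨b, hb⟩)
    obtain ⟨b, hb⟩ := this
    refine ⟨(i, b), hiT, congrArg S.face ?_⟩
    apply Set.Subset.antisymm
    · intro k hk
      by_cases hki : k.1 = i
      · rcases eq_or_eq_opp (l := (i, b)) hki with h | h
        · exact Or.inl h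
        · exact absurd (h ▸ hk) (hT' _ hb)
      · right
        have : k.1 ∉ freeDir T := by
          intro hkT
          have : k.1 ∈ freeDir T \ freeDir T' :=
            Finset.mem_sdiff.2 ⟨hkT, fun h => mem_freeDir.1 h k.2 hk⟩
          rw [hi, Finset.mem_singleton] at this
          exact hki this
        rw [mem_freeDir] at this
        push Not at this
        obtain ⟨c, hc⟩ := this
        rcases eq_or_eq_opp (k := k) (l := (k.1, c)) rfl with h | h
        · rw [h]; exact hc
        · exact absurd (h ▸ hk) (hT' _ (hTT' hc))
    · exact Set.insert_subset hb hTT'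
  · rintro ⟨k, hk, rfl⟩
    have hT' := hT.insert hk
    refine ⟨S.isExposed_face (Set.subset_insert k T), S.face_nonempty hT', ?_⟩
    rw [S.affDim_face hT', S.affDim_face hT, freeDir_insert, Finset.card_erase_add_one hk]

theorem consistent_singleton (k : Fin n × Bool) : Consistent ({k} : Set (Fin n × Bool)) := by
  have := (consistent_empty (n := n)).insert (k := k) (by simp [freeDir_empty])
  simpa using this

theorem isFacet_face_empty_iff {F : Set (Fin n → ℝ)} :
    IsFacet (S.face ∅) F ↔ ∃ k, F = S.face {k} := by
  rw [S.isFacet_iff consistent_empty]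
  simp [freeDir_empty]

theorem face_singleton_injective : Function.Injective fun k => S.face {k} := by
  intro k l h
  have := S.face_injOn (consistent_singleton k) (consistent_singleton l) h
  simpa using this

theorem mem_affineSpan_face_iff {k : Fin n × Bool} {x : Fin n → ℝ} :
    x ∈ affineSpan ℝ (S.face {k}) ↔ S.g k x = 0 := by
  obtain ⟨s, hs⟩ := (consistent_singleton k).exists_sign
  have hsk : s k.1 = k.2 := hs k rfl
  have hv : S.v s ∈ affineSpan ℝ (S.face {k}) := subset_affineSpan ℝ _ (S.v_mem_face hs)
  constructor
  · intro hx
    have : affineSpan ℝ (S.face {k}) ≤ 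
        (AffineSubspace.mk' (0 : ℝ) ⊥).comap (S.g k) := by
      rw [affineSpan_le]
      intro y hy
      simp [AffineSubspace.mem_mk', hy.2 k rfl]
    have h2 := this hx
    simpa [AffineSubspace.mem_mk'] using h2
  · intro hx
    rw [← AffineSubspace.vsub_right_mem_direction_iff_mem hv, direction_affineSpan,
      S.vectorSpan_face s hs, vsub_eq_sub, S.eq_sum_edge s (x - S.v s)]
    refine Submodule.sum_mem _ fun j _ => ?_
    by_cases hj : j ∈ freeDir ({k} : Set (Fin n × Bool))
    · exact Submodule.smul_mem _ _ (Submodule.subset_span ⟨⟨j, hj⟩, rfl⟩)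
    · have hj : j = k.1 := by
        rw [mem_freeDir] at hj
        push Not at hj
        obtain ⟨b, hb⟩ := hj
        exact congrArg Prod.fst hb
      have : ((j, s j) : Fin n × Bool) = k := by rw [hj, hsk]
      rw [S.linear_sub, S.g_self, this, hx]
      simp

theorem mem_interior_face_empty {x : Fin n → ℝ} (hx : ∀ k, 0 < S.g k x) :
    x ∈ interior (S.face ∅) := by
  have hopen : IsOpen (⋂ k, {y | 0 < S.g k y}) :=
    isOpen_iInter_of_finite fun k =>
      isOpen_lt continuous_const (AffineMap.continuous_of_finiteDimensional (S.g k))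
  refine interior_maximal ?_ hopen (Set.mem_iInter.2 hx)
  intro y hy
  exact ⟨fun k => (Set.mem_iInter.1 hy k).le, by simp⟩

theorem active_empty : S.active ∅ = Set.univ := by
  ext k; simp [active]

theorem face_univ (hn : 1 ≤ n) : S.face Set.univ = ∅ := by
  rw [Set.eq_empty_iff_forall_notMem]
  intro x hx
  exact S.consistent_of_face_nonempty ⟨x, hx⟩ (⟨0, hn⟩, true) trivial trivial

theorem face_active_of_isExposed (hn : 1 ≤ n) {F : Set (Fin n → ℝ)} (hF : IsExposed ℝ (S.face ∅) F) :
    S.face (S.active F) = F := by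
  rcases F.eq_empty_or_nonempty with rfl | hne
  · rw [S.active_empty, S.face_univ hn]
  · exact (S.eq_face_active hF hne).symm

/-- This covers the empty face too, whose active set is everything and hence inconsistent; for `1 ≤
n` the full label set gives back the empty face in either system. -/
theorem active_face_active (S' : CubeSystem n) (hn : 1 ≤ n) (F : Set (Fin n → ℝ)) :
    S'.active (S'.face (S.active (S.face (S.active F)))) = S.active (S.face (S.active F)) := by
  by_cases h : Consistent (S.active F)
  · rw [S.active_face h, S'.active_face h]
  · have : S.face (S.active F) = ∅ := by
      by_contra h'
      exact h (S.consistent_of_face_nonempty (Set.nonempty_iff_ne_empty.2 h'))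
    rw [this, S.active_empty, S'.face_univ hn, S'.active_empty]

/-- The isomorphism of the face lattices of the polytopes given by two systems. -/
def faceIso (S S' : CubeSystem n) (hn : 1 ≤ n) : Face (S.face ∅) ≃o Face (S'.face ∅) where
  toFun F := ⟨S'.face (S.active F.1), S'.isExposed_face (Set.empty_subset _)⟩
  invFun F := ⟨S.face (S'.active F.1), S.isExposed_face (Set.empty_subset _)⟩
  left_inv F := by
    apply Subtype.ext
    have h := S.active_face_active S' hn F.1
    rw [S.face_active_of_isExposed hn F.2] at h
    simp only [h, S.face_active_of_isExposed hn F.2]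
  right_inv F := by
    apply Subtype.ext
    have h := S'.active_face_active S hn F.1
    rw [S'.face_active_of_isExposed hn F.2] at h
    simp only [h, S'.face_active_of_isExposed hn F.2]
  map_rel_iff' {F G} := by
    have hF := S.active_face_active S' hn F.1
    rw [S.face_active_of_isExposed hn F.2] at hF
    have hG := S.active_face_active S' hn G.1
    rw [S.face_active_of_isExposed hn G.2] at hG
    constructor
    · intro h
      have h : S'.face (S.active F.1) ⊆ S'.face (S.active G.1) := h
      have h2 : S.active G.1 ⊆ S.active F.1 := by
        rw [← hF, ← hG]
        exact fun k hk x hx => hk x (h hx)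
      have h3 := S.face_mono h2
      rw [S.face_active_of_isExposed hn F.2, S.face_active_of_isExposed hn G.2] at h3
      exact h3
    · intro h
      exact S'.face_mono fun k hk x hx => hk x (h hx)

theorem faceIso_face_singleton (S' : CubeSystem n) (hn : 1 ≤ n) (k : Fin n × Bool)
    (hF : IsExposed ℝ (S.face ∅) (S.face {k})) :
    (S.faceIso S' hn ⟨S.face {k}, hF⟩ : Set (Fin n → ℝ)) = S'.face {k} := by
  simp only [faceIso, RelIso.coe_fn_mk, Equiv.coe_fn_mk]
  rw [S.active_face (consistent_singleton k)]

end CubeSystem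

/-! ### Linked orderings and the combinatorial shelling step -/

/-- `l` lists once each of the facet labels with directions in `U`. -/
def Enumerates {n : ℕ} (U : Finset (Fin n)) (l : List (Fin n × Bool)) : Prop :=
  l.Nodup ∧ ∀ k, k ∈ l ↔ k.1 ∈ U

/-- Every proper nonempty initial segment of `l` contains a label but not its opposite. -/
def Linked {n : ℕ} (l : List (Fin n × Bool)) : Prop :=
  ∀ m, 0 < m → m < l.length → ∃ k ∈ l.take m, opp k ∉ l.take m

theorem Enumerates.length_eq {n : ℕ} {U : Finset (Fin n)} {l : List (Fin n × Bool)}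
    (h : Enumerates U l) : l.length = 2 * U.card := by
  classical
  have h1 : l.toFinset = U ×ˢ (Finset.univ : Finset Bool) := by
    ext k; simp [h.2 k]
  rw [← List.toFinset_card_of_nodup h.1, h1, Finset.card_product]
  simp [mul_comm]

theorem getElem_notMem_take {α : Type*} {l : List α} (h : l.Nodup) {j : ℕ} (hj : j < l.length) :
    l[j] ∉ l.take j := by
  have h2 := List.take_succ_eq_append_getElem hj
  have h3 : (l.take (j + 1)).Nodup := h.sublist (List.take_sublist _ _)
  rw [h2, List.nodup_append] at h3
  intro hmem
  exact h3.2.2 _ hmem _ (List.mem_singleton_self _) rfl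

theorem mem_take_succ {α : Type*} {l : List α} {j : ℕ} (hj : j < l.length) {k : α} :
    k ∈ l.take (j + 1) ↔ k ∈ l.take j ∨ k = l[j] := by
  rw [List.take_succ_eq_append_getElem hj, List.mem_append, List.mem_singleton]

/-- List `a` first, then the rest of `S`, then the remaining labels, and `opp a` last. Every proper
nonempty initial segment contains `a` without `opp a`. -/
theorem exists_linked_of_unpaired {n : ℕ} {U : Finset (Fin n)} {S : Finset (Fin n × Bool)}
    (hS : ∀ k ∈ S, k.1 ∈ U) {a : Fin n × Bool} (ha : a ∈ S) (ha' : opp a ∉ S) :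
    ∃ g, Enumerates U g ∧ Linked g ∧ ∃ r ≤ g.length, ∀ k, k ∈ S ↔ k ∈ g.take r := by
  classical
  let R : Finset (Fin n × Bool) := ((U ×ˢ Finset.univ) \ S).erase (opp a)
  have hR : ∀ k, k ∈ R ↔ k ≠ opp a ∧ k.1 ∈ U ∧ k ∉ S := by
    intro k; simp [R]
  have haU : a.1 ∈ U := hS a ha
  have hne : opp a ≠ a := opp_ne a
  refine ⟨(a :: (S.erase a).toList) ++ (R.toList ++ [opp a]), ⟨?_, ?_⟩, ?_, (S.erase a).card + 1, ?_, ?_⟩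
  · rw [List.nodup_append, List.nodup_cons, List.nodup_append]
    refine ⟨⟨by simp, Finset.nodup_toList _⟩, ⟨Finset.nodup_toList _, by simp, ?_⟩, ?_⟩
    · intro x hx y hy
      simp only [Finset.mem_toList, hR] at hx
      simp only [List.mem_singleton] at hy
      rw [hy]; exact hx.1
    · intro x hx y hy hxy
      subst hxy
      have hxS : x ∈ S := by
        simp only [List.mem_cons, Finset.mem_toList, Finset.mem_erase] at hx
        rcases hx with rfl | hx
        · exact ha
        · exact hx.2
      simp only [List.mem_append, Finset.mem_toList, hR, List.mem_singleton] at hy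
      rcases hy with hy | rfl
      · exact hy.2.2 hxS
      · exact ha' hxS
  · intro k
    simp only [List.mem_append, List.mem_cons, Finset.mem_toList, Finset.mem_erase, hR,
      List.not_mem_nil, or_false]
    constructor
    · rintro ((rfl | h) | (h | rfl))
      · exact haU
      · exact hS k h.2
      · exact h.2.1
      · exact haU
    · intro hk
      by_cases h1 : k = a
      · exact Or.inl (Or.inl h1)
      by_cases h2 : k = opp a
      · exact Or.inr (Or.inr h2)
      by_cases h3 : k ∈ S
      · exact Or.inl (Or.inr ⟨h1, h3⟩)
      · exact Or.inr (Or.inl ⟨h2, hk, h3⟩)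
  · intro m hm0 hm
    obtain ⟨m, rfl⟩ := Nat.exists_eq_add_one_of_ne_zero hm0.ne'
    refine ⟨a, by simp, ?_⟩
    -- Regrouping isolates the final `opp a`, which a proper initial segment never reaches.
    rw [← List.append_assoc, List.take_append_of_le_length (by simp at hm ⊢; omega)]
    intro hmem
    have hmem := List.mem_of_mem_take hmem
    simp only [List.mem_append, List.mem_cons, Finset.mem_toList, Finset.mem_erase, hR] at hmem
    rcases hmem with (h | h) | h
    · exact hne h
    · exact ha' h.2
    · exact h.1 rfl
  · simp
  · intro k
    rw [List.take_left' (by simp)]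
    simp only [List.mem_cons, Finset.mem_toList, Finset.mem_erase]
    constructor
    · intro hk
      by_cases h1 : k = a
      · exact Or.inl h1
      · exact Or.inr ⟨h1, hk⟩
    · rintro (rfl | h)
      · exact ha
      · exact h.2

theorem exists_linked {n : ℕ} {U : Finset (Fin n)} (hU : U.Nonempty) {S : Finset (Fin n × Bool)}
    (hS : ∀ k ∈ S, k.1 ∈ U)
    (h : S = ∅ ∨ (∀ k : Fin n × Bool, k.1 ∈ U → k ∈ S) ∨ ∃ a ∈ S, opp a ∉ S) :
    ∃ g, Enumerates U g ∧ Linked g ∧ ∃ r ≤ g.length, ∀ k, k ∈ S ↔ k ∈ g.take r := by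
  obtain ⟨i, hi⟩ := hU
  have h0 : ∃ g, Enumerates U g ∧ Linked g := by
    obtain ⟨g, hg, hg', -⟩ := exists_linked_of_unpaired (U := U) (S := {(i, true)}) (a := (i, true))
      (by simpa using hi) (by simp) (by simp [opp])
    exact ⟨g, hg, hg'⟩
  rcases h with rfl | h | ⟨a, ha, ha'⟩
  · obtain ⟨g, hg, hg'⟩ := h0
    exact ⟨g, hg, hg', 0, Nat.zero_le _, by simp⟩
  · obtain ⟨g, hg, hg'⟩ := h0
    refine ⟨g, hg, hg', g.length, le_rfl, fun k => ?_⟩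
    rw [List.take_length, hg.2]
    exact ⟨hS k, h k⟩
  · exact exists_linked_of_unpaired hS ha ha'

/-- The combinatorial form of the recursive step in the definition of a shelling. -/
def ShellingStep {n : ℕ} (U : Finset (Fin n)) (l : List (Fin n × Bool)) : Prop :=
  ∀ (j : ℕ) (hj : j < l.length), (0 < j → ∃ k ∈ l.take j, k.1 ≠ l[j].1) ∧
    ∃ g, Enumerates (U.erase l[j].1) g ∧ Linked g ∧ ∃ r ≤ g.length,
      ∀ k, (k ∈ l.take j ∧ k.1 ≠ l[j].1) ↔ k ∈ g.take r

/-- The earlier labels in directions other than that of `l[j]` must be none, all, or contain an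
unpaired one. An unpaired label among the first `j` serves unless it is `opp l[j]`; in that case the
segment of length `j + 1` supplies another, or else that segment is the whole list and all other
labels have occurred. -/
theorem Linked.shellingStep {n : ℕ} {U : Finset (Fin n)} (hU : 2 ≤ U.card)
    {l : List (Fin n × Bool)} (hl : Enumerates U l) (h : Linked l) : ShellingStep U l := by
  classical
  intro j hj
  have hjU : l[j].1 ∈ U := (hl.2 _).1 (List.getElem_mem hj)
  have hcard : (U.erase l[j].1).card + 1 = U.card := Finset.card_erase_add_one hjU
  have hUne : (U.erase l[j].1).Nonempty := Finset.card_pos.1 (by omega)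
  have hnot := getElem_notMem_take hl.1 hj
  have hlen := hl.length_eq
  have hcase : 0 < j → (∀ k : Fin n × Bool, k.1 ∈ U.erase l[j].1 → k ∈ l.take j ∧ k.1 ≠ l[j].1) ∨
      ∃ k ∈ l.take j, k.1 ≠ l[j].1 ∧ opp k ∉ l.take j := by
    intro hj0
    obtain ⟨k, hk, hk'⟩ := h j hj0 hj
    by_cases hki : k.1 = l[j].1
    · have hkl : k = opp l[j] := (eq_or_eq_opp hki).resolve_left fun h => hnot (h ▸ hk)
      by_cases hj1 : j + 1 < l.length
      · right
        obtain ⟨k', hk1, hk2⟩ := h (j + 1) (Nat.succ_pos j) hj1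
        rw [mem_take_succ hj] at hk1 hk2
        push Not at hk2
        rcases hk1 with hk1 | rfl
        · refine ⟨k', hk1, fun hi => ?_, hk2.1⟩
          rcases eq_or_eq_opp hi with h | h
          · exact hnot (h ▸ hk1)
          · exact hk2.2 (by rw [h, opp_opp])
        · exact absurd (hkl ▸ hk) hk2.1
      · left
        intro k' hk'
        rw [Finset.mem_erase] at hk'
        refine ⟨?_, hk'.1⟩
        have h1 := (hl.2 k').2 hk'.2
        have h2 : l.take (j + 1) = l := List.take_of_length_le (by omega)
        rw [← h2, mem_take_succ hj] at h1
        exact h1.resolve_right fun h => hk'.1 (by rw [h])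
    · exact Or.inr ⟨k, hk, hki, hk'⟩
  constructor
  · intro hj0
    rcases hcase hj0 with h | ⟨k, hk, hk', -⟩
    · obtain ⟨i, hi⟩ := hUne
      exact ⟨(i, true), h (i, true) hi⟩
    · exact ⟨k, hk, hk'⟩
  · let S : Finset (Fin n × Bool) := (l.take j).toFinset.filter fun k => k.1 ≠ l[j].1
    have hS : ∀ k, k ∈ S ↔ k ∈ l.take j ∧ k.1 ≠ l[j].1 := by intro k; simp [S]
    have := exists_linked hUne (S := S) (fun k hk => by
        rw [hS] at hk
        exact Finset.mem_erase.2 ⟨hk.2, (hl.2 k).1 (List.mem_of_mem_take hk.1)⟩) (by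
        rcases Nat.eq_zero_or_pos j with hj0 | hj0
        · left
          ext k
          rw [hS]; simp [hj0]
        · right
          rcases hcase hj0 with h | ⟨k, hk, hk', hk''⟩
          · exact Or.inl fun k hk => (hS k).2 (h k hk)
          · exact Or.inr ⟨k, (hS k).2 ⟨hk, hk'⟩, fun h => hk'' ((hS _).1 h).1⟩)
    simpa only [hS] using this

/-- Suppose the segment ending in `l[j]` is closed under opposites. Then so is the set of facets of
`l[j]` covered earlier. It is nonempty and initial in a linked list, hence complete, so the segment
was already the whole list. -/
theorem ShellingStep.linked {n : ℕ} {U : Finset (Fin n)} {l : List (Fin n × Bool)}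
    (hl : Enumerates U l) (h : ShellingStep U l) : Linked l := by
  intro m hm0 hm
  by_contra hcon
  push Not at hcon
  obtain ⟨j, rfl⟩ := Nat.exists_eq_add_one_of_ne_zero hm0.ne'
  have hj : j < l.length := by omega
  have hnot := getElem_notMem_take hl.1 hj
  have hopp : opp l[j] ∈ l.take j :=
    ((mem_take_succ hj).1 (hcon l[j] ((mem_take_succ hj).2 (Or.inr rfl)))).resolve_right (opp_ne _)
  have hj0 : 0 < j := by
    rcases Nat.eq_zero_or_pos j with rfl | h
    · simp at hopp
    · exact h
  obtain ⟨h1, g, hg, hgl, r, hr, hgr⟩ := h j hj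
  obtain ⟨k, hk, hki⟩ := h1 hj0
  have hkr : k ∈ g.take r := (hgr k).1 ⟨hk, hki⟩
  have hr0 : 0 < r := by
    rcases Nat.eq_zero_or_pos r with rfl | h
    · simp at hkr
    · exact h
  rcases hr.lt_or_eq with hr | rfl
  · obtain ⟨a, ha, ha'⟩ := hgl r hr0 hr
    rw [← hgr] at ha ha'
    refine ha' ⟨?_, ha.2⟩
    have := hcon a ((mem_take_succ hj).2 (Or.inl ha.1))
    -- The opposite of `a` is not `l[j]` itself, because `a` has a different direction.
    exact ((mem_take_succ hj).1 this).resolve_right fun h => ha.2 (by rw [← h]; rfl)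
  · have hsub : l ⊆ l.take (j + 1) := by
      intro k hk
      rw [mem_take_succ hj]
      by_cases hki : k.1 = l[j].1
      · rcases eq_or_eq_opp hki with h | h
        · exact Or.inr h
        · exact Or.inl (h ▸ hopp)
      · left
        refine ((hgr k).2 ?_).1
        rw [List.take_length, hg.2, Finset.mem_erase]
        exact ⟨hki, (hl.2 k).1 hk⟩
    have := (List.subperm_of_subset hl.1 hsub).length_le
    simp at this
    omega

theorem Enumerates.linked_of_card_eq_one {n : ℕ} {U : Finset (Fin n)} (hU : U.card = 1)
    {l : List (Fin n × Bool)} (hl : Enumerates U l) : Linked l := by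
  intro m hm0 hm
  have := hl.length_eq
  obtain rfl : m = 1 := by omega
  have h0 : 0 < l.length := by omega
  have : ∀ k, k ∈ l.take 1 ↔ k = l[0] := by
    intro k
    rw [mem_take_succ h0]; simp
  exact ⟨l[0], (this _).2 rfl, fun h => opp_ne _ ((this _).1 h)⟩

theorem mem_prefixUnion_map {E α : Type*} [NormedAddCommGroup E] [NormedSpace ℝ E] (f : α → Set E)
    (l : List α) (r : ℕ) (x : E) :
    x ∈ prefixUnion (l.map f) r ↔ ∃ k ∈ l.take r, x ∈ f k := by
  simp [prefixUnion, ← List.map_take]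

/-! ### Geometric shellings as linked orderings -/

namespace CubeSystem

variable {n : ℕ} (S : CubeSystem n)

theorem face_insert_injOn {T : Set (Fin n × Bool)} (hT : Consistent T) {k l : Fin n × Bool}
    (hk : k.1 ∈ freeDir T) (hl : l.1 ∈ freeDir T) (h : S.face (insert k T) = S.face (insert l T)) :
    k = l := by
  have h2 := S.face_injOn (hT.insert hk) (hT.insert hl) h
  have h3 : k ∈ insert l T := h2 ▸ Set.mem_insert k T
  exact h3.resolve_right fun h => mem_freeDir.1 hk k.2 h

theorem isFacetOrdering_iff {T : Set (Fin n × Bool)} (hT : Consistent T)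
    {L : List (Set (Fin n → ℝ))} :
    IsFacetOrdering (S.face T) L ↔
      ∃ l, Enumerates (freeDir T) l ∧ L = l.map fun k => S.face (insert k T) := by
  have hinj : Function.Injective
      fun k : {k : Fin n × Bool // k.1 ∈ freeDir T} => S.face (insert k.1 T) :=
    fun k l h => Subtype.ext (S.face_insert_injOn hT k.2 l.2 h)
  constructor
  · rintro ⟨hnd, hmem⟩
    have : L ∈ Set.range (List.map
        fun k : {k : Fin n × Bool // k.1 ∈ freeDir T} => S.face (insert k.1 T)) := by
      rw [Set.range_list_map]
      intro F hF
      obtain ⟨k, hk, rfl⟩ := (S.isFacet_iff hT).1 ((hmem F).1 hF)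
      exact ⟨⟨k, hk⟩, rfl⟩
    obtain ⟨l, rfl⟩ := this
    refine ⟨l.map Subtype.val, ⟨?_, fun k => ?_⟩, by simp⟩
    · exact (List.Nodup.of_map _ hnd).map Subtype.val_injective
    · constructor
      · intro hk
        obtain ⟨k', -, rfl⟩ := List.mem_map.1 hk
        exact k'.2
      · intro hk
        have := (hmem _).2 ((S.isFacet_iff hT).2 ⟨k, hk, rfl⟩)
        obtain ⟨k', hk', h⟩ := List.mem_map.1 this
        have h := S.face_insert_injOn hT k'.2 hk h
        exact List.mem_map.2 ⟨k', hk', h⟩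
  · rintro ⟨l, hl, rfl⟩
    refine ⟨?_, fun F => ?_⟩
    · refine List.Nodup.map_on ?_ hl.1
      intro k hk k' hk' h
      exact S.face_insert_injOn hT ((hl.2 k).1 hk) ((hl.2 k').1 hk') h
    · rw [S.isFacet_iff hT, List.mem_map]
      constructor
      · rintro ⟨k, hk, rfl⟩
        exact ⟨k, (hl.2 k).1 hk, rfl⟩
      · rintro ⟨k, hk, rfl⟩
        exact ⟨k, (hl.2 k).2 hk, rfl⟩

/-- A generic point of a facet lies on no other facet, so a union of facets determines the set of
its labels. This turns equality of unions into equality of label sets. -/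
theorem face_insert_union_subset {T : Set (Fin n × Bool)} (hT : Consistent T)
    {A B : Set (Fin n × Bool)} (hA : ∀ k ∈ A, k.1 ∈ freeDir T) (hB : ∀ k ∈ B, k.1 ∈ freeDir T)
    (h : ∀ x, (∃ k ∈ A, x ∈ S.face (insert k T)) → ∃ k ∈ B, x ∈ S.face (insert k T)) : A ⊆ B := by
  intro k hk
  obtain ⟨x, hx, hgen⟩ := S.exists_generic_face (hT.insert (hA k hk))
  obtain ⟨k', hk', hx'⟩ := h x ⟨k, hk, hx⟩
  have := (hgen k').1 (hx'.2 k' (Set.mem_insert _ _))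
  rcases this with rfl | h
  · exact hk'
  · exact absurd h (mem_freeDir.1 (hB k' hk') k'.2)

/-- An earlier facet opposite to `l[j]` contributes nothing, being disjoint from it; every other
earlier facet meets `l[j]` in one of its facets. -/
theorem face_inter_prefixUnion {T : Set (Fin n × Bool)} {l : List (Fin n × Bool)} (hl : l.Nodup)
    {j : ℕ} (hj : j < l.length) (x : Fin n → ℝ) :
    x ∈ S.face (insert l[j] T) ∩ prefixUnion (l.map fun k => S.face (insert k T)) j ↔
      ∃ k, (k ∈ l.take j ∧ k.1 ≠ l[j].1) ∧ x ∈ S.face (insert k (insert l[j] T)) := by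
  rw [Set.mem_inter_iff, mem_prefixUnion_map]
  constructor
  · rintro ⟨hx, k, hk, hxk⟩
    have hx' : x ∈ S.face (insert k (insert l[j] T)) := by
      rw [← Set.union_singleton, ← S.face_inter]
      exact ⟨hx, S.face_mono (by simp) hxk⟩
    refine ⟨k, ⟨hk, fun h => ?_⟩, hx'⟩
    rcases eq_or_eq_opp h with h | h
    · exact getElem_notMem_take hl hj (h ▸ hk)
    · refine S.consistent_of_face_nonempty ⟨x, hx'⟩ l[j] (by simp) ?_
      rw [← h]; simp
  · rintro ⟨k, ⟨hk, -⟩, hx⟩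
    exact ⟨S.face_mono (Set.subset_insert _ _) hx, k, hk,
      S.face_mono (Set.insert_subset_insert (Set.subset_insert _ _)) hx⟩

theorem isShellingOfDim_iff (d : ℕ) : ∀ {T : Set (Fin n × Bool)}, Consistent T →
    (freeDir T).card = d + 1 → ∀ {L : List (Set (Fin n → ℝ))},
    (IsShellingOfDim (d + 1) (S.face T) L ↔
      ∃ l, Enumerates (freeDir T) l ∧ Linked l ∧ L = l.map fun k => S.face (insert k T)) := by
  induction d with
  | zero =>
    intro T hT hd L
    rw [IsShellingOfDim, S.isFacetOrdering_iff hT]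
    refine exists_congr fun l => ⟨fun ⟨h1, h2⟩ => ⟨h1, h1.linked_of_card_eq_one hd, h2⟩,
      fun ⟨h1, _, h2⟩ => ⟨h1, h2⟩⟩
  | succ d ih =>
    intro T hT hd L
    rw [IsShellingOfDim, S.isFacetOrdering_iff hT]
    -- By the induction hypothesis the shellings of each facet are the linked orderings of its
    -- labels, which makes the geometric recursion equal to `ShellingStep`.
    have key : ∀ l, Enumerates (freeDir T) l → (ShellingStep (freeDir T) l ↔
        ∀ (j : ℕ) (hj : j < (l.map fun k => S.face (insert k T)).length),
        (0 < j → ((l.map fun k => S.face (insert k T))[j] ∩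
          prefixUnion (l.map fun k => S.face (insert k T)) j).Nonempty) ∧
        ∃ G : List (Set (Fin n → ℝ)),
          IsShellingOfDim (d + 1) (l.map fun k => S.face (insert k T))[j] G ∧
          ∃ r ≤ G.length, (l.map fun k => S.face (insert k T))[j] ∩
            prefixUnion (l.map fun k => S.face (insert k T)) j = prefixUnion G r) := by
      intro l hl
      rw [ShellingStep]
      simp only [List.length_map, List.getElem_map]
      refine forall_congr' fun j => forall_congr' fun hj => ?_
      have hjT : l[j].1 ∈ freeDir T := (hl.2 _).1 (List.getElem_mem hj)
      have hTj := hT.insert hjT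
      have hfree : ∀ k ∈ l.take j, k.1 ≠ l[j].1 → k.1 ∈ freeDir (insert l[j] T) := by
        intro k hk hkj
        rw [freeDir_insert]
        exact Finset.mem_erase.2 ⟨hkj, (hl.2 k).1 (List.mem_of_mem_take hk)⟩
      refine and_congr (forall_congr' fun hj0 => ?_) ?_
      · constructor
        · rintro ⟨k, hk, hkj⟩
          obtain ⟨x, hx⟩ := S.face_nonempty (hTj.insert (hfree k hk hkj))
          exact ⟨x, (S.face_inter_prefixUnion hl.1 hj x).2 ⟨k, ⟨hk, hkj⟩, hx⟩⟩
        · rintro ⟨x, hx⟩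
          obtain ⟨k, ⟨hk, hkj⟩, -⟩ := (S.face_inter_prefixUnion hl.1 hj x).1 hx
          exact ⟨k, hk, hkj⟩
      · have hcard : (freeDir (insert l[j] T)).card = d + 1 := by
          rw [freeDir_insert, Finset.card_erase_of_mem hjT]; omega
        have heq : ∀ g, Enumerates (freeDir (insert l[j] T)) g → ∀ r,
            ((∀ k, (k ∈ l.take j ∧ k.1 ≠ l[j].1) ↔ k ∈ g.take r) ↔
            S.face (insert l[j] T) ∩ prefixUnion (l.map fun k => S.face (insert k T)) j =
              prefixUnion (g.map fun k => S.face (insert k (insert l[j] T))) r) := by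
          intro g hg r
          have hgfree : ∀ k ∈ g.take r, k.1 ∈ freeDir (insert l[j] T) := fun k hk =>
            (hg.2 k).1 (List.mem_of_mem_take hk)
          constructor
          · intro h
            ext x
            rw [S.face_inter_prefixUnion hl.1 hj, mem_prefixUnion_map]
            simp only [h]
          · intro h
            have h' : ∀ x, (∃ k, (k ∈ l.take j ∧ k.1 ≠ l[j].1) ∧
                x ∈ S.face (insert k (insert l[j] T))) ↔
                ∃ k ∈ g.take r, x ∈ S.face (insert k (insert l[j] T)) := by
              intro x
              rw [← S.face_inter_prefixUnion hl.1 hj, h, mem_prefixUnion_map]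
            have h1 := S.face_insert_union_subset hTj
              (A := {k | k ∈ l.take j ∧ k.1 ≠ l[j].1}) (B := {k | k ∈ g.take r})
              (fun k hk => hfree k hk.1 hk.2) hgfree fun x => (h' x).1
            have h2 := S.face_insert_union_subset hTj
              (B := {k | k ∈ l.take j ∧ k.1 ≠ l[j].1}) (A := {k | k ∈ g.take r})
              hgfree (fun k hk => hfree k hk.1 hk.2) fun x => (h' x).2
            exact fun k => ⟨fun hk => h1 hk, fun hk => h2 hk⟩
        simp only [ih hTj hcard]
        rw [← freeDir_insert]
        constructor
        · rintro ⟨g, hg, hgl, r, hr, h⟩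
          exact ⟨_, ⟨g, hg, hgl, rfl⟩, r, by simpa using hr, (heq g hg r).1 h⟩
        · rintro ⟨_, ⟨g, hg, hgl, rfl⟩, r, hr, h⟩
          exact ⟨g, hg, hgl, r, by simpa using hr, (heq g hg r).2 h⟩
    constructor
    · rintro ⟨⟨l, hl, rfl⟩, h⟩
      exact ⟨l, hl, ((key l hl).2 h).linked hl, rfl⟩
    · rintro ⟨l, hl, hll, rfl⟩
      exact ⟨⟨l, hl, rfl⟩, (key l hl).1 (hll.shellingStep (by omega) hl)⟩

theorem isShelling_iff (hn : 1 ≤ n) {L : List (Set (Fin n → ℝ))} :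
    IsShelling (S.face ∅) L ↔
      ∃ l, Enumerates Finset.univ l ∧ Linked l ∧ L = l.map fun k => S.face {k} := by
  obtain ⟨d, rfl⟩ := Nat.exists_eq_add_one_of_ne_zero (Nat.one_le_iff_ne_zero.1 hn)
  have hcard : (freeDir (∅ : Set (Fin (d + 1) × Bool))).card = d + 1 := by simp [freeDir_empty]
  rw [IsShelling, S.affDim_face consistent_empty, hcard,
    S.isShellingOfDim_iff d consistent_empty hcard, freeDir_empty]
  simp

end CubeSystem

/-! ### The standard cube and the count of its shellings -/

/-- The functionals `xᵢ` and `1 - xᵢ`, which define the standard cube. -/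
def stdSystem (n : ℕ) : CubeSystem n where
  g k := if k.2 then AffineMap.const ℝ _ 1 - (LinearMap.proj k.1 : (Fin n → ℝ) →ₗ[ℝ] ℝ).toAffineMap
    else (LinearMap.proj k.1 : (Fin n → ℝ) →ₗ[ℝ] ℝ).toAffineMap
  v s i := if s i then 1 else 0
  g_self s i := by cases h : s i <;> simp [h]
  g_not s i := by cases h : s i <;> simp [h]

theorem stdSystem_g_true {n : ℕ} (i : Fin n) (x : Fin n → ℝ) :
    (stdSystem n).g (i, true) x = 1 - x i := by simp [stdSystem]

theorem stdSystem_g_false {n : ℕ} (i : Fin n) (x : Fin n → ℝ) :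
    (stdSystem n).g (i, false) x = x i := by simp [stdSystem]

theorem stdSystem_face_empty (n : ℕ) : (stdSystem n).face ∅ = stdCube n := by
  ext x
  simp only [CubeSystem.face, stdCube, Set.mem_ofPred_eq, Prod.forall, Bool.forall_bool,
    stdSystem_g_true, stdSystem_g_false, Set.mem_empty_iff_false, false_imp_iff, implies_true,
    and_true, sub_nonneg]

/-- The enumerations of the facet labels with directions in `U`. -/
noncomputable def enumLists {n : ℕ} (U : Finset (Fin n)) : Finset (List (Fin n × Bool)) := by
  classical exact (U ×ˢ Finset.univ).toList.permutations.toFinset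

theorem mem_enumLists {n : ℕ} {U : Finset (Fin n)} {l : List (Fin n × Bool)} :
    l ∈ enumLists U ↔ Enumerates U l := by
  classical
  have h0 : (U ×ˢ (Finset.univ : Finset Bool)).toList.Nodup := Finset.nodup_toList _
  simp only [enumLists, List.mem_toFinset, List.mem_permutations]
  constructor
  · intro h
    refine ⟨h.nodup_iff.2 h0, fun k => ?_⟩
    rw [h.mem_iff]; simp
  · rintro ⟨h1, h2⟩
    rw [List.perm_ext_iff_of_nodup h1 h0]
    intro k
    rw [h2]; simp

theorem card_enumLists {n : ℕ} (U : Finset (Fin n)) : (enumLists U).card = (2 * U.card)! := by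
  classical
  rw [enumLists, List.toFinset_card_of_nodup
    (List.nodup_permutations _ (Finset.nodup_toList _)), List.length_permutations,
    Finset.length_toList, Finset.card_product, mul_comm]
  simp

/-- The linked enumerations of the facet labels with directions in `U`. -/
noncomputable def linkedLists {n : ℕ} (U : Finset (Fin n)) : Finset (List (Fin n × Bool)) := by
  classical exact (enumLists U).filter Linked

theorem mem_linkedLists {n : ℕ} {U : Finset (Fin n)} {l : List (Fin n × Bool)} :
    l ∈ linkedLists U ↔ Enumerates U l ∧ Linked l := by
  simp [linkedLists, mem_enumLists]

theorem Enumerates.ext_iff {n : ℕ} {U V : Finset (Fin n)} {l : List (Fin n × Bool)}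
    (h : Enumerates U l) (h' : Enumerates V l) : U = V := by
  ext i
  rw [← h.2 (i, true), ← h'.2 (i, true)]

/-- A linked list cannot extend properly beyond a nonempty initial segment closed under opposites.
Used both ways round, this makes the decomposition with linked first block unique. -/
theorem append_linked_le {n : ℕ} {U : Finset (Fin n)} (hU : U.Nonempty)
    {l₁ l₂ l₁' l₂' : List (Fin n × Bool)} (h : Enumerates U l₁)
    (hl : Linked l₁') (heq : l₁ ++ l₂ = l₁' ++ l₂') : l₁'.length ≤ l₁.length := by
  by_contra hlt
  push Not at hlt
  have hpos : 0 < l₁.length := by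
    rw [h.length_eq]
    have := Finset.card_pos.2 hU
    omega
  obtain ⟨k, hk, hk'⟩ := hl l₁.length hpos hlt
  have htake : l₁'.take l₁.length = l₁ := by
    have h1 : (l₁' ++ l₂').take l₁.length = l₁'.take l₁.length :=
      List.take_append_of_le_length hlt.le
    rw [← h1, ← heq, List.take_left]
  rw [htake] at hk hk'
  exact hk' ((h.2 _).2 ((h.2 k).1 hk))

/-- Cut each ordering after its shortest nonempty initial segment closed under opposites. That
segment is a linked ordering of the labels over some `V`, and the rest is an arbitrary ordering of
the labels over `U \ V`. -/
theorem card_enumLists_eq_sum {n : ℕ} {U : Finset (Fin n)} (hU : U.Nonempty) :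
    (enumLists U).card =
      ∑ V ∈ U.powerset.erase ∅, (linkedLists V).card * (enumLists (U \ V)).card := by
  classical
  simp_rw [← Finset.card_product]
  rw [← Finset.card_sigma]
  symm
  refine Finset.card_nbij (fun p => p.2.1 ++ p.2.2) ?_ ?_ ?_
  · rintro ⟨V, l₁, l₂⟩ hp
    simp only [Finset.mem_coe, Finset.mem_sigma, Finset.mem_erase, Finset.mem_powerset, Finset.mem_product,
      mem_linkedLists, mem_enumLists] at hp ⊢
    obtain ⟨⟨-, hV⟩, ⟨h1, -⟩, h2⟩ := hp
    refine ⟨List.nodup_append.2 ⟨h1.1, h2.1, ?_⟩, fun k => ?_⟩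
    · rintro k hk k' hk' rfl
      exact (Finset.mem_sdiff.1 ((h2.2 k).1 hk')).2 ((h1.2 k).1 hk)
    · rw [List.mem_append, h1.2, h2.2, Finset.mem_sdiff]
      constructor
      · rintro (h | h)
        · exact hV h
        · exact h.1
      · intro h
        by_cases hk : k.1 ∈ V
        · exact Or.inl hk
        · exact Or.inr ⟨h, hk⟩
  · rintro ⟨V, l₁, l₂⟩ hp ⟨V', l₁', l₂'⟩ hp' heq
    simp only [Finset.mem_coe, Finset.mem_sigma, Finset.mem_erase, Finset.mem_product,
      mem_linkedLists, mem_enumLists] at hp hp' heq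
    obtain ⟨⟨hV, -⟩, ⟨h1, h2⟩, -⟩ := hp
    obtain ⟨⟨hV', -⟩, ⟨h1', h2'⟩, -⟩ := hp'
    have hlen := (append_linked_le (Finset.nonempty_iff_ne_empty.2 hV') h1' h2 heq.symm).antisymm
      (append_linked_le (Finset.nonempty_iff_ne_empty.2 hV) h1 h2' heq)
    obtain ⟨rfl, rfl⟩ := List.append_inj heq hlen
    obtain rfl := h1.ext_iff h1'
    rfl
  · intro l hl
    rw [Finset.mem_coe, mem_enumLists] at hl
    have hex : ∃ m, 0 < m ∧ ∀ k ∈ l.take m, opp k ∈ l.take m := by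
      refine ⟨l.length, ?_, ?_⟩
      · rw [hl.length_eq]
        have := Finset.card_pos.2 hU
        omega
      · intro k hk
        rw [List.take_length] at hk ⊢
        exact (hl.2 _).2 ((hl.2 k).1 hk)
    let m := Nat.find hex
    obtain ⟨hm0, hm⟩ : 0 < m ∧ ∀ k ∈ l.take m, opp k ∈ l.take m := Nat.find_spec hex
    have hmin : ∀ m' < m, ¬(0 < m' ∧ ∀ k ∈ l.take m', opp k ∈ l.take m') :=
      fun m' h => Nat.find_min hex h
    let V := U.filter fun i => (i, true) ∈ l.take m
    have hV : ∀ k : Fin n × Bool, k ∈ l.take m ↔ k.1 ∈ V := by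
      intro k
      simp only [V, Finset.mem_filter]
      constructor
      · intro hk
        refine ⟨(hl.2 k).1 (List.mem_of_mem_take hk), ?_⟩
        rcases eq_or_eq_opp (k := (k.1, true)) (l := k) rfl with h | h
        · rw [h]; exact hk
        · rw [h]; exact hm k hk
      · rintro ⟨-, hk⟩
        rcases eq_or_eq_opp (k := k) (l := (k.1, true)) rfl with h | h
        · rw [h]; exact hk
        · rw [h]; exact hm _ hk
    have hnd := hl.1
    rw [← List.take_append_drop m l, List.nodup_append] at hnd
    refine ⟨⟨V, l.take m, l.drop m⟩, ?_, List.take_append_drop m l⟩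
    simp only [Finset.mem_coe, Finset.mem_sigma, Finset.mem_erase, Finset.mem_product,
      mem_linkedLists, mem_enumLists, Finset.mem_powerset]
    refine ⟨⟨?_, Finset.filter_subset _ _⟩, ⟨⟨hnd.1, hV⟩, ?_⟩, hnd.2.1, fun k => ?_⟩
    · intro h0
      have hpos : 0 < l.length := by
        rw [hl.length_eq]
        have := Finset.card_pos.2 hU
        omega
      have : l[0] ∈ l.take m := by
        rw [List.mem_take_iff_getElem]
        exact ⟨0, by omega, rfl⟩
      rw [hV, h0] at this
      simp at this
    · intro m' h0 hm'
      rw [List.length_take] at hm'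
      have := hmin m' (by omega)
      push Not at this
      rw [List.take_take, min_eq_left (by omega)]
      exact this h0
    · rw [Finset.mem_sdiff, ← hV, ← hl.2 k]
      constructor
      · intro hk
        exact ⟨List.mem_of_mem_drop hk, fun h => hnd.2.2 k h k hk rfl⟩
      · rintro ⟨h1, h2⟩
        rw [← List.take_append_drop m l, List.mem_append] at h1
        exact h1.resolve_left h2

/-- The count satisfies the same recurrence as `H`. The recurrence determines its top term, whose
coefficient is `0! = 1`, from the terms of smaller index. -/
theorem card_linkedLists {n : ℕ} (H : ℕ → ℚ) (h0 : H 0 = 0)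
    (hH : ∀ m, 0 < m → ∑ k ∈ Finset.range (m + 1), (m.choose k : ℚ) * (H k * ((2 * (m - k))! : ℚ)) =
      ((2 * m)! : ℚ)) (U : Finset (Fin n)) (hU : U.Nonempty) :
    ((linkedLists U).card : ℚ) = H U.card := by
  classical
  induction U using Finset.strongInduction with
  | H U ih =>
  have h1 := congrArg (Nat.cast : ℕ → ℚ) (card_enumLists_eq_sum hU)
  have h2 := hH U.card (Finset.card_pos.2 hU)
  have h3 := Finset.sum_powerset_apply_card (fun k => H k * ((2 * (U.card - k))! : ℚ)) (x := U)
  simp only [nsmul_eq_mul] at h3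
  rw [← h3] at h2
  have hne : (∅ : Finset (Fin n)) ∈ U.powerset := by simp
  rw [← Finset.add_sum_erase _ _ hne] at h2
  simp only [Finset.card_empty, h0, zero_mul, zero_add] at h2
  rw [card_enumLists] at h1
  rw [← h2] at h1
  have hU' : U ∈ U.powerset.erase ∅ := by simp [hU.ne_empty]
  push_cast at h1
  rw [← Finset.add_sum_erase _ _ hU', ← Finset.add_sum_erase _ _ hU'] at h1
  have h4 : ∑ V ∈ (U.powerset.erase ∅).erase U, H V.card * ((2 * (U.card - V.card))! : ℚ) =
      ∑ V ∈ (U.powerset.erase ∅).erase U, ((linkedLists V).card : ℚ) * (enumLists (U \ V)).card := by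
    refine Finset.sum_congr rfl fun V hV => ?_
    simp only [Finset.mem_erase, Finset.mem_powerset] at hV
    rw [ih V (hV.2.2.ssubset_of_ne hV.1) (Finset.nonempty_iff_ne_empty.2 hV.2.1), card_enumLists,
      Finset.card_sdiff_of_subset hV.2.2]
  rw [h4, card_enumLists] at h1
  have h5 := add_right_cancel h1
  simp at h5
  exact h5.symm

theorem numCubeShellings_eq {n : ℕ} (hn : 1 ≤ n) :
    numCubeShellings n = (linkedLists (Finset.univ : Finset (Fin n))).card := by
  have : shellings (stdCube n) =
      List.map (fun k => (stdSystem n).face {k}) '' (linkedLists (Finset.univ : Finset (Fin n))) := by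
    ext L
    rw [shellings, Set.mem_ofPred_eq, ← stdSystem_face_empty, (stdSystem n).isShelling_iff hn]
    simp only [Set.mem_image, Finset.mem_coe, mem_linkedLists]
    exact ⟨fun ⟨l, h1, h2, h3⟩ => ⟨l, ⟨h1, h2⟩, h3.symm⟩, fun ⟨l, ⟨h1, h2⟩, h3⟩ => ⟨l, h1, h2, h3.symm⟩⟩
  rw [numCubeShellings, this, Set.ncard_image_of_injective _
    (List.map_injective_iff.2 (stdSystem n).face_singleton_injective), Set.ncard_coe_finset]

theorem cubeShellings_generatingFunction :
    PowerSeries.mk (fun n : ℕ => if n = 0 then (0 : ℚ) else (numCubeShellings n : ℚ) / (n ! : ℚ)) =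
      1 - (PowerSeries.mk (fun n : ℕ => ((2 * n)! : ℚ) / (n ! : ℚ)))⁻¹ := by
  set G : PowerSeries ℚ := PowerSeries.mk (fun n : ℕ => ((2 * n)! : ℚ) / (n ! : ℚ)) with hG
  have hG0 : PowerSeries.constantCoeff G ≠ 0 := by
    rw [← PowerSeries.coeff_zero_eq_constantCoeff_apply, hG, PowerSeries.coeff_mk]; simp
  set F := 1 - G⁻¹ with hF
  have hFG : F * G = G - 1 := by rw [hF, sub_mul, one_mul, PowerSeries.inv_mul_cancel _ hG0]
  have hF0 : PowerSeries.coeff 0 F = 0 := by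
    simp [hF, hG]
  ext n
  rw [PowerSeries.coeff_mk]
  split_ifs with hn
  · rw [hn, hF0]
  · have hn' : 1 ≤ n := Nat.one_le_iff_ne_zero.2 hn
    have hfac : ∀ m : ℕ, (m ! : ℚ) ≠ 0 := fun m => by exact_mod_cast m.factorial_ne_zero
    -- The recurrence for `k! * coeff k F` is the coefficient form of `F * G = G - 1`, multiplied by
    -- `m!`.
    have key := card_linkedLists (n := n) (fun k => (k ! : ℚ) * PowerSeries.coeff k F) (by simp [hF0])
      (fun m hm => ?_) Finset.univ ⟨⟨0, hn'⟩, Finset.mem_univ _⟩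
    · rw [numCubeShellings_eq hn', key, Finset.card_univ, Fintype.card_fin,
        mul_div_cancel_left₀ _ (hfac n)]
    · have h1 := congrArg (PowerSeries.coeff m) hFG
      rw [PowerSeries.coeff_mul, Finset.Nat.sum_antidiagonal_eq_sum_range_succ_mk, map_sub,
        PowerSeries.coeff_one, if_neg hm.ne', sub_zero, hG] at h1
      simp only [PowerSeries.coeff_mk] at h1
      have h2 := congrArg (fun q => (m ! : ℚ) * q) h1
      simp only [mul_div_cancel₀ _ (hfac m), Finset.mul_sum] at h2
      rw [← h2]
      refine Finset.sum_congr rfl fun k hk => ?_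
      have hk : k ≤ m := Nat.lt_succ_iff.1 (Finset.mem_range.1 hk)
      rw [← Nat.choose_mul_factorial_mul_factorial hk]
      push_cast
      field_simp [hfac]

/-! ### Line shellings of the standard cube -/

theorem CubeSystem.isLineShellingAlong_iff {n : ℕ} (S : CubeSystem n) {p v : Fin n → ℝ}
    {L : List (Set (Fin n → ℝ))} :
    IsLineShellingAlong (S.face ∅) p v L ↔ p ∈ interior (S.face ∅) ∧
      ∃ l, Enumerates Finset.univ l ∧ (L = l.map fun k => S.face {k}) ∧
        (∀ k, (S.g k).linear v ≠ 0) ∧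
        l.Pairwise fun k k' =>
          MetBefore (-S.g k p / (S.g k).linear v) (-S.g k' p / (S.g k').linear v) := by
  rw [IsLineShellingAlong, S.isFacetOrdering_iff consistent_empty, freeDir_empty]
  simp only [insert_empty_eq]
  refine and_congr_right fun _ => ?_
  have hline : ∀ k t, p + t • v ∈ affineSpan ℝ (S.face {k}) ↔ S.g k p + t * (S.g k).linear v = 0 := by
    intro k t
    rw [S.mem_affineSpan_face_iff, S.g_add, map_smul, smul_eq_mul]
  constructor
  · rintro ⟨⟨l, hl, rfl⟩, τ, hτ, hpair⟩
    have hτ' : ∀ k t, S.g k p + t * (S.g k).linear v = 0 ↔ t = τ (S.face {k}) := by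
      intro k t
      rw [← hline]
      exact hτ _ (List.mem_map.2 ⟨k, (hl.2 k).2 (Finset.mem_univ _), rfl⟩) t
    have hv : ∀ k, (S.g k).linear v ≠ 0 := by
      intro k h0
      have h1 := (hτ' k _).2 rfl
      have h2 := (hτ' k (τ (S.face {k}) + 1)).1 (by rw [h0] at h1 ⊢; simpa using h1)
      linarith
    have ht : ∀ k, τ (S.face {k}) = -S.g k p / (S.g k).linear v := by
      intro k
      symm
      rw [← hτ', div_mul_cancel₀ _ (hv k)]
      ring
    refine ⟨l, hl, rfl, hv, ?_⟩
    rw [List.pairwise_map] at hpair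
    simpa only [ht] using hpair
  · rintro ⟨l, hl, rfl, hv, hpair⟩
    refine ⟨⟨l, hl, rfl⟩, Function.extend (fun k => S.face {k})
      (fun k => -S.g k p / (S.g k).linear v) 0, ?_, ?_⟩
    · intro F hF t
      obtain ⟨k, -, rfl⟩ := List.mem_map.1 hF
      rw [S.face_singleton_injective.extend_apply, hline, eq_div_iff (hv k), eq_neg_iff_add_eq_zero,
        add_comm]
    · rw [List.pairwise_map]
      simpa only [S.face_singleton_injective.extend_apply] using hpair

theorem mem_interior_stdCube {n : ℕ} {x : Fin n → ℝ} :
    x ∈ interior (stdCube n) ↔ ∀ i, 0 < x i ∧ x i < 1 := by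
  have : stdCube n = Set.pi Set.univ fun _ => Set.Icc (0 : ℝ) 1 := by
    ext y
    simp only [stdCube, Set.mem_ofPred_eq, Set.mem_pi, Set.mem_univ, true_imp_iff, Set.mem_Icc]
  rw [this, interior_pi_set Set.finite_univ]
  simp [interior_Icc]

theorem stdSystem_linear_true {n : ℕ} (i : Fin n) (x : Fin n → ℝ) :
    ((stdSystem n).g (i, true)).linear x = -x i := by simp [stdSystem]

theorem stdSystem_linear_false {n : ℕ} (i : Fin n) (x : Fin n → ℝ) :
    ((stdSystem n).g (i, false)).linear x = x i := by simp [stdSystem]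

/-- The parameter at which the line `t ↦ p + t • v` meets the facet hyperplane of the cube
labelled `k`. -/
noncomputable def crossing {n : ℕ} (p v : Fin n → ℝ) (k : Fin n × Bool) : ℝ :=
  -(stdSystem n).g k p / ((stdSystem n).g k).linear v

theorem crossing_true {n : ℕ} (p v : Fin n → ℝ) (i : Fin n) :
    crossing p v (i, true) = (1 - p i) / v i := by
  rw [crossing, stdSystem_g_true, stdSystem_linear_true, neg_div_neg_eq]

theorem crossing_false {n : ℕ} (p v : Fin n → ℝ) (i : Fin n) :
    crossing p v (i, false) = -p i / v i := by
  rw [crossing, stdSystem_g_false, stdSystem_linear_false]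

theorem isLineShellingAlong_stdCube_iff {n : ℕ} {p v : Fin n → ℝ} {L : List (Set (Fin n → ℝ))} :
    IsLineShellingAlong (stdCube n) p v L ↔ (∀ i, 0 < p i ∧ p i < 1) ∧
      ∃ l, Enumerates Finset.univ l ∧ (L = l.map fun k => (stdSystem n).face {k}) ∧
        (∀ i, v i ≠ 0) ∧ l.Pairwise fun k k' => MetBefore (crossing p v k) (crossing p v k') := by
  rw [← mem_interior_stdCube, ← stdSystem_face_empty, CubeSystem.isLineShellingAlong_iff]
  simp only [Prod.forall, Bool.forall_bool, stdSystem_linear_false, stdSystem_linear_true, ne_eq,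
    neg_eq_zero, and_self, crossing]

theorem MetBefore.pos {s t : ℝ} (h : MetBefore s t) (ht : 0 < t) : 0 < s := by
  rcases h with h | h
  · exact h.1
  · exact pos_of_mul_pos_left h.1 ht.le

theorem MetBefore.lt_of_pos {s t : ℝ} (h : MetBefore s t) (ht : 0 < t) : s < t := by
  rcases h with h | h
  · linarith
  · exact h.2

theorem MetBefore.lt_of_neg {s t : ℝ} (h : MetBefore s t) (hs : s < 0) : s < t := by
  rcases h with h | h
  · linarith
  · exact h.2

/-- Applied with `q` saying that a crossing has positive parameter, this cuts a line shelling at the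
passage through infinity. -/
theorem eq_filter_append_filter {α : Type*} {R : α → α → Prop} {q : α → Prop} [DecidablePred q]
    (hR : ∀ a b, R a b → q b → q a) {l : List α} (hl : l.Pairwise R) :
    l = l.filter q ++ l.filter fun a => ¬q a := by
  induction l with
  | nil => rfl
  | cons a l ih =>
    rw [List.pairwise_cons] at hl
    by_cases ha : q a
    · simp only [List.filter_cons, ha, decide_true, if_true, not_true, decide_false,
        List.cons_append, Bool.false_eq_true, if_false]
      rw [← ih hl.2]
    · have hb : ∀ b ∈ l, ¬q b := fun b hb hq => ha (hR a b (hl.1 b hb) hq)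
      have h1 : (a :: l).filter q = [] := by
        rw [List.filter_eq_nil_iff]
        intro b hb'
        rcases List.mem_cons.1 hb' with rfl | hb'
        · simpa using ha
        · simpa using hb b hb'
      have h2 : ((a :: l).filter fun a => ¬q a) = a :: l := by
        rw [List.filter_eq_self]
        intro b hb'
        rcases List.mem_cons.1 hb' with rfl | hb'
        · simpa using ha
        · simpa using hb b hb'
      rw [h1, h2, List.nil_append]

/-- The lists of facet labels in which the facets with signs `s` come first, in directions ordered
by `l₁`, followed by the opposite ones, in directions ordered by `l₂`. -/
def signedList {n : ℕ} (s : Fin n → Bool) (l₁ l₂ : List (Fin n)) : List (Fin n × Bool) :=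
  (l₁.map fun i => (i, s i)) ++ l₂.map fun i => (i, !s i)

/-- The orderings of the directions. -/
noncomputable def orderings (n : ℕ) : Finset (List (Fin n)) :=
  (Finset.univ : Finset (Fin n)).toList.permutations.toFinset

theorem mem_orderings {n : ℕ} {l : List (Fin n)} : l ∈ orderings n ↔ l.Nodup ∧ ∀ i, i ∈ l := by
  have h0 : (Finset.univ : Finset (Fin n)).toList.Nodup := Finset.nodup_toList _
  simp only [orderings, List.mem_toFinset, List.mem_permutations]
  constructor
  · intro h
    exact ⟨h.nodup_iff.2 h0, fun k => by rw [h.mem_iff]; simp⟩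
  · rintro ⟨h1, h2⟩
    rw [List.perm_ext_iff_of_nodup h1 h0]
    simp [h2]

theorem card_orderings (n : ℕ) : (orderings n).card = n ! := by
  rw [orderings, List.toFinset_card_of_nodup (List.nodup_permutations _ (Finset.nodup_toList _)),
    List.length_permutations, Finset.length_toList, Finset.card_univ, Fintype.card_fin]

theorem perm_of_mem_orderings {n : ℕ} {l l' : List (Fin n)} (h : l ∈ orderings n)
    (h' : l' ∈ orderings n) : l.Perm l' := by
  rw [mem_orderings] at h h'
  rw [List.perm_ext_iff_of_nodup h.1 h'.1]
  simp [h.2, h'.2]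

theorem signedList_injOn {n : ℕ} : Set.InjOn
    (fun x : (Fin n → Bool) × List (Fin n) × List (Fin n) => signedList x.1 x.2.1 x.2.2)
    {x | x.2.1 ∈ orderings n ∧ x.2.2 ∈ orderings n} := by
  rintro ⟨s, l₁, l₂⟩ ⟨h1, -⟩ ⟨s', l₁', l₂'⟩ ⟨h1', -⟩ heq
  simp only [signedList] at h1 h1' heq
  obtain ⟨e1, e2⟩ := List.append_inj heq
    (by rw [List.length_map, List.length_map, (perm_of_mem_orderings h1 h1').length_eq])
  have f1 := congrArg (List.map Prod.fst) e1
  have f2 := congrArg (List.map Prod.fst) e2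
  simp only [List.map_map, Function.comp_def, List.map_id'] at f1 f2
  subst f1 f2
  have hs : s = s' := by
    funext i
    have := List.map_inj_left.1 e1 i ((mem_orderings.1 h1).2 i)
    exact congrArg Prod.snd this
  rw [hs]

theorem enumerates_signedList {n : ℕ} (s : Fin n → Bool) {l₁ l₂ : List (Fin n)}
    (h₁ : l₁ ∈ orderings n) (h₂ : l₂ ∈ orderings n) :
    Enumerates Finset.univ (signedList s l₁ l₂) := by
  rw [mem_orderings] at h₁ h₂
  constructor
  · rw [signedList, List.nodup_append]
    refine ⟨h₁.1.map fun i j h => congrArg Prod.fst h, h₂.1.map fun i j h => congrArg Prod.fst h, ?_⟩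
    rintro k hk k' hk' rfl
    obtain ⟨i, -, rfl⟩ := List.mem_map.1 hk
    obtain ⟨j, -, h⟩ := List.mem_map.1 hk'
    obtain ⟨rfl, h⟩ := Prod.mk.inj h
    simp at h
  · rintro ⟨i, b⟩
    simp only [signedList, List.mem_append, List.mem_map, Finset.mem_univ, iff_true, Prod.mk.injEq]
    by_cases h : s i = b
    · exact Or.inl ⟨i, h₁.2 i, rfl, h⟩
    · exact Or.inr ⟨i, h₂.2 i, rfl, by revert h; cases b <;> cases s i <;> simp⟩

theorem exists_signedList_of_isLineShellingAlong {n : ℕ} {p v : Fin n → ℝ}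
    {L : List (Set (Fin n → ℝ))} (h : IsLineShellingAlong (stdCube n) p v L) :
    ∃ (s : Fin n → Bool) (l₁ l₂ : List (Fin n)), l₁ ∈ orderings n ∧ l₂ ∈ orderings n ∧
      (L = (signedList s l₁ l₂).map fun k => (stdSystem n).face {k}) ∧
      (l₁.Pairwise fun i j => crossing p v (i, s i) < crossing p v (j, s j)) ∧
      l₂.Pairwise fun i j => crossing p v (i, !s i) < crossing p v (j, !s j) := by
  rw [isLineShellingAlong_stdCube_iff] at h
  obtain ⟨hp, l, hl, rfl, hv, hpair⟩ := h
  -- Of the hyperplanes `xᵢ = 0` and `xᵢ = 1`, the line approaches the one selected by the sign of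
  -- `v i`, and it has crossed the other at a negative parameter.
  let s : Fin n → Bool := fun i => decide (0 < v i)
  have hpos : ∀ i, 0 < crossing p v (i, s i) := by
    intro i
    by_cases hi : 0 < v i
    · have : s i = true := by simp [s, hi]
      rw [this, crossing_true]
      exact div_pos (by linarith [hp i]) hi
    · have : s i = false := by simp [s, hi]
      rw [this, crossing_false]
      exact div_pos_of_neg_of_neg (by linarith [hp i]) (lt_of_le_of_ne (not_lt.1 hi) (hv i))
  have hneg : ∀ i, crossing p v (i, !s i) < 0 := by
    intro i
    by_cases hi : 0 < v i
    · have : (!s i) = false := by simp [s, hi]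
      rw [this, crossing_false]
      exact div_neg_of_neg_of_pos (by linarith [hp i]) hi
    · have : (!s i) = true := by simp [s]; simpa using hi
      rw [this, crossing_true]
      exact div_neg_of_pos_of_neg (by linarith [hp i]) (lt_of_le_of_ne (not_lt.1 hi) (hv i))
  have hcase : ∀ k : Fin n × Bool, ¬k.2 = s k.1 → k.2 = !s k.1 := by
    rintro ⟨i, b⟩ h
    revert h; simp only; cases b <;> cases s i <;> simp
  have hq : ∀ k : Fin n × Bool, 0 < crossing p v k ↔ k.2 = s k.1 := by
    intro k
    constructor
    · intro h
      by_contra hk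
      have := hneg k.1
      rw [← hcase k hk] at this
      exact lt_asymm h this
    · intro h
      have := hpos k.1
      rwa [← h] at this
  have hdec := eq_filter_append_filter (q := fun k : Fin n × Bool => k.2 = s k.1)
    (fun a b hab hb => (hq a).1 (hab.pos ((hq b).2 hb))) hpair
  set m₁ := l.filter (fun k => k.2 = s k.1) with hm₁
  set m₂ := l.filter (fun k => ¬k.2 = s k.1) with hm₂
  have hmem₁ : ∀ k, k ∈ m₁ ↔ k.2 = s k.1 := by
    intro k; simp [hm₁, hl.2]
  have hmem₂ : ∀ k, k ∈ m₂ ↔ k.2 = !s k.1 := by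
    intro k
    simp only [hm₂, List.mem_filter, hl.2, Finset.mem_univ, decide_eq_true_eq, true_and]
    exact ⟨hcase k, fun h h' => by rw [h] at h'; simp at h'⟩
  have e₁ : m₁ = (m₁.map Prod.fst).map fun i => (i, s i) := by
    rw [List.map_map]
    conv_lhs => rw [← List.map_id m₁]
    exact List.map_congr_left fun k hk => Prod.ext rfl ((hmem₁ k).1 hk)
  have e₂ : m₂ = (m₂.map Prod.fst).map fun i => (i, !s i) := by
    rw [List.map_map]
    conv_lhs => rw [← List.map_id m₂]
    exact List.map_congr_left fun k hk => Prod.ext rfl ((hmem₂ k).1 hk)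
  have hp₁ : m₁.Pairwise fun k k' => MetBefore (crossing p v k) (crossing p v k') := hpair.filter _
  have hp₂ : m₂.Pairwise fun k k' => MetBefore (crossing p v k) (crossing p v k') := hpair.filter _
  have hn₁ : m₁.Nodup := hl.1.filter _
  have hn₂ : m₂.Nodup := hl.1.filter _
  refine ⟨s, m₁.map Prod.fst, m₂.map Prod.fst, ?_, ?_, ?_, ?_, ?_⟩
  · rw [e₁] at hn₁
    refine mem_orderings.2 ⟨List.Nodup.of_map _ hn₁, fun i => ?_⟩
    exact List.mem_map.2 ⟨(i, s i), (hmem₁ _).2 rfl, rfl⟩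
  · rw [e₂] at hn₂
    refine mem_orderings.2 ⟨List.Nodup.of_map _ hn₂, fun i => ?_⟩
    exact List.mem_map.2 ⟨(i, !s i), (hmem₂ _).2 rfl, rfl⟩
  · rw [signedList, ← e₁, ← e₂, ← hdec]
  · rw [e₁, List.pairwise_map] at hp₁
    exact hp₁.imp fun h => h.lt_of_pos (hpos _)
  · rw [e₂, List.pairwise_map] at hp₂
    exact hp₂.imp fun h => h.lt_of_neg (hneg _)

/-- The crossing parameters are prescribed as `a i` and `-b i`. The line covers the unit width of
the cube in direction `i` in time `a i + b i`, which fixes both its speed and its position at time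
zero. -/
theorem isLineShellingAlong_signedList {n : ℕ} (s : Fin n → Bool) {l₁ l₂ : List (Fin n)}
    (h₁ : l₁ ∈ orderings n) (h₂ : l₂ ∈ orderings n) {a b : Fin n → ℝ} (ha : ∀ i, 0 < a i)
    (hb : ∀ i, 0 < b i) (hl₁ : l₁.Pairwise fun i j => a i < a j)
    (hl₂ : l₂.Pairwise fun i j => b j < b i) :
    IsLineShellingAlong (stdCube n) (fun i => (if s i then b i else a i) / (a i + b i))
      (fun i => (if s i then 1 else -1) / (a i + b i))
      ((signedList s l₁ l₂).map fun k => (stdSystem n).face {k}) := by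
  have hab : ∀ i, 0 < a i + b i := fun i => add_pos (ha i) (hb i)
  rw [isLineShellingAlong_stdCube_iff]
  set p : Fin n → ℝ := fun i => (if s i then b i else a i) / (a i + b i) with hp
  set v : Fin n → ℝ := fun i => (if s i then 1 else -1) / (a i + b i) with hv
  have hpos : ∀ i, crossing p v (i, s i) = a i := by
    intro i
    have := (hab i).ne'
    cases h : s i
    · rw [crossing_false]; simp only [hp, hv, h, Bool.false_eq_true, if_false]; field_simp
    · rw [crossing_true]; simp only [hp, hv, h, if_true]; field_simp; ring
  have hneg : ∀ i, crossing p v (i, !s i) = -b i := by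
    intro i
    have := (hab i).ne'
    cases h : s i
    · rw [Bool.not_false, crossing_true]
      simp only [hp, hv, h, Bool.false_eq_true, if_false]; field_simp; ring
    · rw [Bool.not_true, crossing_false]; simp only [hp, hv, h, if_true]; field_simp
  refine ⟨fun i => ?_, signedList s l₁ l₂, enumerates_signedList s h₁ h₂, rfl, fun i => ?_, ?_⟩
  · rw [lt_div_iff₀ (hab i), div_lt_one (hab i)]
    have := ha i; have := hb i
    split_ifs <;> constructor <;> linarith
  · refine div_ne_zero ?_ (hab i).ne'
    split_ifs <;> norm_num
  · rw [signedList, List.pairwise_append, List.pairwise_map, List.pairwise_map]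
    refine ⟨hl₁.imp fun {i j} h => ?_, hl₂.imp fun {i j} h => ?_, ?_⟩
    · rw [hpos, hpos]
      exact Or.inr ⟨mul_pos (ha i) (ha j), h⟩
    · rw [hneg, hneg]
      exact Or.inr ⟨by rw [neg_mul_neg]; exact mul_pos (hb i) (hb j), neg_lt_neg h⟩
    · intro k hk k' hk'
      obtain ⟨i, -, rfl⟩ := List.mem_map.1 hk
      obtain ⟨j, -, rfl⟩ := List.mem_map.1 hk'
      rw [hpos, hneg]
      exact Or.inl ⟨ha i, neg_lt_zero.2 (hb j)⟩

theorem pairwise_idxOf {n : ℕ} {l : List (Fin n)} (h : l ∈ orderings n) :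
    l.Pairwise fun i j => (l.idxOf i : ℝ) < l.idxOf j := by
  rw [List.pairwise_iff_getElem]
  intro i j hi hj hij
  rw [(mem_orderings.1 h).1.idxOf_getElem, (mem_orderings.1 h).1.idxOf_getElem]
  exact_mod_cast hij

theorem lineShellings_stdCube (n : ℕ) : lineShellings (stdCube n) =
    (fun x : (Fin n → Bool) × List (Fin n) × List (Fin n) =>
      (signedList x.1 x.2.1 x.2.2).map fun k => (stdSystem n).face {k}) ''
      (Finset.univ ×ˢ orderings n ×ˢ orderings n :
        Finset ((Fin n → Bool) × List (Fin n) × List (Fin n))) := by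
  ext L
  constructor
  · rintro ⟨p, v, h⟩
    obtain ⟨s, l₁, l₂, h₁, h₂, rfl, -, -⟩ := exists_signedList_of_isLineShellingAlong h
    exact ⟨(s, l₁, l₂), by simp [h₁, h₂], rfl⟩
  · rintro ⟨⟨s, l₁, l₂⟩, h, rfl⟩
    simp only [Finset.coe_product, Finset.coe_univ, Set.mem_prod, Set.mem_univ, Finset.mem_coe,
      true_and] at h
    -- The values `b` must decrease along `l₂`, since the crossings there occur at `-b`; subtracting
    -- the index from the length also keeps them positive.
    refine ⟨_, _, isLineShellingAlong_signedList s h.1 h.2 (a := fun i => l₁.idxOf i + 1)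
      (b := fun i => l₂.length - l₂.idxOf i) (fun i => by positivity) (fun i => ?_) ?_ ?_⟩
    · have := List.idxOf_lt_length_of_mem ((mem_orderings.1 h.2).2 i)
      simp only [sub_pos]
      exact_mod_cast this
    · exact (pairwise_idxOf h.1).imp fun h => by linarith
    · exact (pairwise_idxOf h.2).imp fun h => by linarith

theorem map_face_signedList_injOn {n : ℕ} : Set.InjOn
    (fun x : (Fin n → Bool) × List (Fin n) × List (Fin n) =>
      (signedList x.1 x.2.1 x.2.2).map fun k => (stdSystem n).face {k})
    {x | x.2.1 ∈ orderings n ∧ x.2.2 ∈ orderings n} := fun _ hx _ hy h =>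
  signedList_injOn hx hy (List.map_injective_iff.2 (stdSystem n).face_singleton_injective h)

theorem ncard_lineShellings_stdCube (n : ℕ) :
    (lineShellings (stdCube n)).ncard = 2 ^ n * (n !) ^ 2 := by
  rw [lineShellings_stdCube, Set.InjOn.ncard_image, Set.ncard_coe_finset, Finset.card_product,
    Finset.card_product, card_orderings, Finset.card_univ, Fintype.card_fun, Fintype.card_bool,
    Fintype.card_fin, sq]
  refine map_face_signedList_injOn.mono fun x hx => ?_
  simpa using hx

theorem lineShellingsThrough_cubeCenter (n : ℕ) :
    lineShellingsThrough (stdCube n) (cubeCenter n) =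
    (fun x : (Fin n → Bool) × List (Fin n) =>
      (signedList x.1 x.2 x.2.reverse).map fun k => (stdSystem n).face {k}) ''
      (Finset.univ ×ˢ orderings n : Finset ((Fin n → Bool) × List (Fin n))) := by
  ext L
  constructor
  · rintro ⟨v, h⟩
    obtain ⟨s, l₁, l₂, h₁, h₂, rfl, hl₁, hl₂⟩ := exists_signedList_of_isLineShellingAlong h
    refine ⟨(s, l₁), by simp [h₁], ?_⟩
    -- The center is halfway between opposite facets, so their crossing parameters are negatives of
    -- each other and the second half of the order is forced.
    have hopp : ∀ i, crossing (cubeCenter n) v (i, !s i) = -crossing (cubeCenter n) v (i, s i) := by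
      intro i
      cases s i
      · rw [Bool.not_false, crossing_true, crossing_false, cubeCenter]; ring
      · rw [Bool.not_true, crossing_true, crossing_false, cubeCenter]; ring
    have hl₂' : l₂.reverse.Pairwise fun i j =>
        crossing (cubeCenter n) v (i, s i) < crossing (cubeCenter n) v (j, s j) := by
      rw [List.pairwise_reverse]
      refine hl₂.imp fun {i j} h => ?_
      rw [hopp, hopp] at h
      linarith
    have heq : l₁ = l₂.reverse :=
      List.Perm.eq_of_pairwise (fun _ _ _ _ h h' => absurd h (lt_asymm h')) hl₁ hl₂'
        ((perm_of_mem_orderings h₁ h₂).trans (List.reverse_perm l₂).symm)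
    simp only [heq, List.reverse_reverse]
  · rintro ⟨⟨s, l⟩, h, rfl⟩
    simp only [Finset.coe_product, Finset.coe_univ, Set.mem_prod, Set.mem_univ, Finset.mem_coe,
      true_and] at h
    have hrev : l.reverse ∈ orderings n := by
      rw [mem_orderings] at h ⊢
      simpa using h
    have hlt : l.Pairwise fun i j => (l.idxOf i : ℝ) + 1 < l.idxOf j + 1 :=
      (pairwise_idxOf h).imp fun h => by linarith
    have := isLineShellingAlong_signedList s h hrev (a := fun i => l.idxOf i + 1)
      (b := fun i => l.idxOf i + 1) (fun i => by positivity) (fun i => by positivity) hlt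
      (List.pairwise_reverse.2 hlt)
    have hcenter : (fun i => (if s i then (l.idxOf i : ℝ) + 1 else (l.idxOf i : ℝ) + 1) /
        ((l.idxOf i : ℝ) + 1 + ((l.idxOf i : ℝ) + 1))) = cubeCenter n := by
      funext i
      have : (l.idxOf i : ℝ) + 1 ≠ 0 := by positivity
      simp only [ite_self, cubeCenter]
      field_simp
      norm_num
    rw [hcenter] at this
    exact ⟨_, this⟩

theorem ncard_lineShellingsThrough_cubeCenter (n : ℕ) :
    (lineShellingsThrough (stdCube n) (cubeCenter n)).ncard = 2 ^ n * n ! := by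
  rw [lineShellingsThrough_cubeCenter, Set.InjOn.ncard_image, Set.ncard_coe_finset,
    Finset.card_product, card_orderings, Finset.card_univ, Fintype.card_fun, Fintype.card_bool,
    Fintype.card_fin]
  rintro ⟨s, l⟩ hx ⟨s', l'⟩ hy h
  have hrev : ∀ l : List (Fin n), l ∈ orderings n → l.reverse ∈ orderings n := by
    intro l h
    rw [mem_orderings] at h ⊢
    simpa using h
  have hx : l ∈ orderings n := by simpa using hx
  have hy : l' ∈ orderings n := by simpa using hy
  have := map_face_signedList_injOn (x₁ := (s, l, l.reverse)) ⟨hx, hrev l hx⟩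
    (x₂ := (s', l', l'.reverse)) ⟨hy, hrev l' hy⟩ h
  simp only [Prod.mk.injEq] at this
  simp [this.1, this.2.1]

/-! ### Cross-polytopes with prescribed vertex heights -/

/-- No threshold separates the opposite pairs of labels into two nonempty classes according to their
heights. -/
def HeightLinked {n : ℕ} (h : Fin n × Bool → ℝ) : Prop :=
  ∀ t, (∀ k, t < h k → t < h (opp k)) → (∀ k, t < h k) ∨ ∀ k, h k ≤ t

/-- `c` lies strictly between the heights of the two labels with direction `i`. -/
def StrictlyBetween {n : ℕ} (h : Fin n × Bool → ℝ) (i : Fin n) (c : ℝ) : Prop :=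
  min (h (i, true)) (h (i, false)) < c ∧ c < max (h (i, true)) (h (i, false))

theorem StrictlyBetween.mul_neg {n : ℕ} {h : Fin n × Bool → ℝ} {i : Fin n} {c : ℝ}
    (hc : StrictlyBetween h i c) (b : Bool) : (h (i, b) - c) * (h (i, !b) - c) < 0 := by
  obtain ⟨h1, h2⟩ := hc
  rw [min_lt_iff] at h1
  rw [lt_max_iff] at h2
  have : (h (i, true) - c) * (h (i, false) - c) < 0 := by
    rcases h1 with h1 | h1 <;> rcases h2 with h2 | h2
    · linarith
    · exact mul_neg_of_neg_of_pos (by linarith) (by linarith)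
    · exact mul_neg_of_pos_of_neg (by linarith) (by linarith)
    · linarith
  cases b
  · rw [mul_comm]; exact this
  · exact this

theorem div_lt_one_of_mul_neg {t t' r : ℝ} (h : t * t' < 0) (h' : (t - r) * (t' - r) < 0) :
    r / t < 1 := by
  rcases mul_neg_iff.1 h with ⟨ht, ht'⟩ | ⟨ht, ht'⟩
  · rw [div_lt_one ht]
    rcases mul_neg_iff.1 h' with ⟨h1, h2⟩ | ⟨h1, h2⟩ <;> linarith
  · rw [div_lt_one_of_neg ht]
    rcases mul_neg_iff.1 h' with ⟨h1, h2⟩ | ⟨h1, h2⟩ <;> linarith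

/-- The sum of the coordinates. -/
def coordSum (n : ℕ) : (Fin n → ℝ) →ₗ[ℝ] ℝ := ∑ i, LinearMap.proj i

theorem coordSum_apply {n : ℕ} (x : Fin n → ℝ) : coordSum n x = ∑ i, x i := by
  simp [coordSum]

/-- A cross-polytope in the coordinate subspace of `S` with vertices `b k` whose coordinate sums are
the heights `h k`; the functionals `ψ s` support its facets. -/
structure CrossPolytope {n : ℕ} (h : Fin n × Bool → ℝ) (S : Finset (Fin n)) where
  /-- The vertices. -/
  b : Fin n × Bool → Fin n → ℝ
  /-- The functionals defining the facets. -/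
  ψ : (Fin n → Bool) → (Fin n → ℝ) →ᵃ[ℝ] ℝ
  height : ∀ k, k.1 ∈ S → coordSum n (b k) = h k
  supp : ∀ k, k.1 ∈ S → ∀ j ∉ S, b k j = 0
  ψ_self : ∀ s, ∀ i ∈ S, ψ s (b (i, s i)) = 0
  ψ_not : ∀ s, ∀ i ∈ S, ψ s (b (i, !s i)) < 0

namespace CrossPolytope

variable {n : ℕ} {h : Fin n × Bool → ℝ} {S : Finset (Fin n)}

/-- The relative interior. -/
def inner (B : CrossPolytope h S) : Set (Fin n → ℝ) :=
  {x | (∀ j ∉ S, x j = 0) ∧ ∀ s, B.ψ s x < 0}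

theorem convex_inner (B : CrossPolytope h S) : Convex ℝ B.inner := by
  intro x hx y hy a b ha hb hab
  refine ⟨fun j hj => ?_, fun s => ?_⟩
  · simp [hx.1 j hj, hy.1 j hj]
  · exact ((convex_Iio (0 : ℝ)).affine_preimage (B.ψ s)) (hx.2 s) (hy.2 s) ha hb hab

theorem ordConnected_heights (B : CrossPolytope h S) :
    (coordSum n '' B.inner).OrdConnected :=
  (B.convex_inner.linear_image (coordSum n)).ordConnected

/-- The cross-polytope of dimension zero. -/
def point (h : Fin n × Bool → ℝ) : CrossPolytope h ∅ where
  b _ := 0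
  ψ _ := AffineMap.const ℝ _ (-1)
  height k hk := by simp at hk
  supp k hk := by simp at hk
  ψ_self s i hi := by simp at hi
  ψ_not s i hi := by simp at hi

theorem zero_mem_inner_point (h : Fin n × Bool → ℝ) : 0 ∈ (point h).inner :=
  ⟨fun _ _ => rfl, fun s => by simp [point]⟩

theorem ψ_add (B : CrossPolytope h S) (s : Fin n → Bool) (x u : Fin n → ℝ) :
    B.ψ s (x + u) = B.ψ s x + (B.ψ s).linear u := by
  have := (B.ψ s).map_vadd x u
  rw [vadd_eq_add, vadd_eq_add, add_comm u x] at this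
  rw [this, add_comm]

/-- The bipyramid with apices `ξ + r • eᵢ`, of heights `h (i, ·)`. -/
noncomputable def bipyramid (B : CrossPolytope h S) {i : Fin n} (hi : i ∉ S) {ξ : Fin n → ℝ} (hξ : ξ ∈ B.inner)
    (hc : StrictlyBetween h i (coordSum n ξ)) : CrossPolytope h (insert i S) where
  b k := if k.1 = i then ξ + (h k - coordSum n ξ) • Pi.single i 1 else B.b k
  -- Subtracting a multiple of `xᵢ` changes nothing at the old vertices, where `xᵢ = 0`. With this
  -- multiple the value at `ξ + r • eᵢ` is `ψ(ξ) * (1 - r / t)`, where `t` is the offset of the apex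
  -- selected by `s`: zero at that apex, and negative whenever `r / t < 1`.
  ψ s := B.ψ s - ((B.ψ s ξ / (h (i, s i) - coordSum n ξ) + (B.ψ s).linear (Pi.single i 1)) •
    (LinearMap.proj i : (Fin n → ℝ) →ₗ[ℝ] ℝ)).toAffineMap
  height k hk := by
    split_ifs with hki
    · rw [map_add, map_smul]
      simp [coordSum_apply]
    · exact B.height k ((Finset.mem_insert.1 hk).resolve_left hki)
  supp k hk j hj := by
    rw [Finset.mem_insert, not_or] at hj
    split_ifs with hki
    · simp [hξ.1 j hj.2, hj.1]
    · exact B.supp k ((Finset.mem_insert.1 hk).resolve_left hki) j hj.2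
  ψ_self s j hj := by
    by_cases hji : j = i
    · subst hji
      have ht : h (j, s j) - coordSum n ξ ≠ 0 := left_ne_zero_of_mul (hc.mul_neg (s j)).ne
      simp only [if_true, AffineMap.coe_sub, Pi.sub_apply, ψ_add, map_smul, smul_eq_mul,
        LinearMap.coe_toAffineMap, LinearMap.smul_apply, LinearMap.proj_apply, Pi.add_apply,
        Pi.smul_apply, Pi.single_eq_same, hξ.1 j hi]
      field_simp
      ring
    · have hj := (Finset.mem_insert.1 hj).resolve_left hji
      simp [hji, B.ψ_self s j hj, B.supp (j, s j) hj i hi]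
  ψ_not s j hj := by
    by_cases hji : j = i
    · subst hji
      have hmul := hc.mul_neg (s j)
      have ht : h (j, s j) - coordSum n ξ ≠ 0 := left_ne_zero_of_mul hmul.ne
      have hneg : (h (j, !s j) - coordSum n ξ) / (h (j, s j) - coordSum n ξ) < 0 := by
        rw [div_neg_iff, ← mul_neg_iff, mul_comm]
        exact hmul
      have hψ := hξ.2 s
      simp only [if_true, AffineMap.coe_sub, Pi.sub_apply, ψ_add, map_smul, smul_eq_mul,
        LinearMap.coe_toAffineMap, LinearMap.smul_apply, LinearMap.proj_apply, Pi.add_apply,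
        Pi.smul_apply, Pi.single_eq_same, hξ.1 j hi]
      have := mul_neg_of_neg_of_pos hψ (show 0 < 1 - (h (j, !s j) - coordSum n ξ) /
        (h (j, s j) - coordSum n ξ) by linarith)
      refine lt_of_eq_of_lt ?_ this
      field_simp
      ring
    · have hj := (Finset.mem_insert.1 hj).resolve_left hji
      simp only [hji, if_false, AffineMap.coe_sub, Pi.sub_apply, LinearMap.coe_toAffineMap,
        LinearMap.smul_apply, LinearMap.proj_apply, B.supp (j, !s j) hj i hi, smul_zero, sub_zero]
      exact B.ψ_not s j hj

theorem inner_subset_inner_bipyramid (B : CrossPolytope h S) {i : Fin n} (hi : i ∉ S)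
    {ξ : Fin n → ℝ} (hξ : ξ ∈ B.inner) (hc : StrictlyBetween h i (coordSum n ξ)) :
    B.inner ⊆ (B.bipyramid hi hξ hc).inner := by
  intro x hx
  refine ⟨fun j hj => hx.1 j fun h => hj (Finset.mem_insert_of_mem h), fun s => ?_⟩
  simp only [bipyramid, AffineMap.coe_sub, Pi.sub_apply, LinearMap.coe_toAffineMap,
    LinearMap.smul_apply, LinearMap.proj_apply, hx.1 i hi, smul_zero, sub_zero]
  exact hx.2 s

/-- The open segment between the two apices lies in the inner part and sweeps all heights strictly
between theirs. -/
theorem mem_heights_bipyramid (B : CrossPolytope h S) {i : Fin n} (hi : i ∉ S)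
    {ξ : Fin n → ℝ} (hξ : ξ ∈ B.inner) (hc : StrictlyBetween h i (coordSum n ξ)) {c : ℝ}
    (hc' : StrictlyBetween h i c) : c ∈ coordSum n '' (B.bipyramid hi hξ hc).inner := by
  refine ⟨ξ + (c - coordSum n ξ) • Pi.single i 1, ⟨fun j hj => ?_, fun s => ?_⟩, ?_⟩
  · rw [Finset.mem_insert, not_or] at hj
    simp [hξ.1 j hj.2, hj.1]
  · have hmul := hc.mul_neg (s i)
    have ht : h (i, s i) - coordSum n ξ ≠ 0 := left_ne_zero_of_mul hmul.ne
    have hlt : (c - coordSum n ξ) / (h (i, s i) - coordSum n ξ) < 1 :=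
      div_lt_one_of_mul_neg hmul (by simpa using hc'.mul_neg (s i))
    have hψ := hξ.2 s
    simp only [bipyramid, AffineMap.coe_sub, Pi.sub_apply, ψ_add, map_smul, smul_eq_mul,
      LinearMap.coe_toAffineMap, LinearMap.smul_apply, LinearMap.proj_apply, Pi.add_apply,
      Pi.smul_apply, Pi.single_eq_same, hξ.1 i hi]
    have := mul_neg_of_neg_of_pos hψ (show 0 < 1 - (c - coordSum n ξ) /
      (h (i, s i) - coordSum n ξ) by linarith)
    refine lt_of_eq_of_lt ?_ this
    field_simp
    ring
  · rw [map_add, map_smul]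
    simp [coordSum_apply]

end CrossPolytope

theorem min_lt_max_of_injective {n : ℕ} {h : Fin n × Bool → ℝ} (hinj : Function.Injective h)
    (i : Fin n) : min (h (i, true)) (h (i, false)) < max (h (i, true)) (h (i, false)) := by
  rw [min_lt_max]
  exact fun h => by simpa using hinj h

theorem min_le_height {n : ℕ} (h : Fin n × Bool → ℝ) (k : Fin n × Bool) :
    min (h (k.1, true)) (h (k.1, false)) ≤ h k := by
  rcases k with ⟨i, b⟩; cases b <;> simp

theorem height_le_max {n : ℕ} (h : Fin n × Bool → ℝ) (k : Fin n × Bool) :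
    h k ≤ max (h (k.1, true)) (h (k.1, false)) := by
  rcases k with ⟨i, b⟩; cases b <;> simp

/-- The set `I` contains all heights strictly between the lowest and the highest label over `S`. If
no further direction worked, each remaining pair would lie wholly below or wholly above this range,
and a threshold would separate opposite pairs, against `HeightLinked`. -/
theorem HeightLinked.exists_strictlyBetween {n : ℕ} {h : Fin n × Bool → ℝ} (hl : HeightLinked h)
    (hinj : Function.Injective h) {S : Finset (Fin n)} (hS : S.Nonempty) (hS' : S ≠ Finset.univ)
    {I : Set ℝ} (hI : I.OrdConnected) (hSI : ∀ i ∈ S, ∀ c, StrictlyBetween h i c → c ∈ I) :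
    ∃ i ∉ S, ∃ c ∈ I, StrictlyBetween h i c := by
  have hlabels : (S ×ˢ (Finset.univ : Finset Bool)).Nonempty := hS.product ⟨true, Finset.mem_univ _⟩
  obtain ⟨lo, hlo, hmin⟩ := Finset.exists_min_image _ h hlabels
  obtain ⟨hi, hhi, hmax⟩ := Finset.exists_max_image _ h hlabels
  simp only [Finset.mem_product, Finset.mem_univ, and_true] at hlo hhi hmin hmax
  have hlohi : h lo < h hi := by
    refine lt_of_le_of_ne (hmin hi hhi) fun heq => ?_
    have h1 := hmin (opp lo) hlo
    have h2 := hmax (opp lo) hlo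
    exact opp_ne lo (hinj (le_antisymm (heq ▸ h2) h1))
  have hsub : ∀ c, h lo < c → c < h hi → c ∈ I := by
    intro c h1 h2
    have a1 : h lo < min c (max (h (lo.1, true)) (h (lo.1, false))) := by
      refine lt_min h1 (lt_of_le_of_lt ?_ (lt_of_lt_of_le (lt_of_le_of_ne (hmin (opp lo) hlo) ?_)
        (height_le_max h (opp lo))))
      · exact le_rfl
      · exact fun heq => opp_ne lo (hinj heq).symm
    have a2 : max c (min (h (hi.1, true)) (h (hi.1, false))) < h hi := by
      refine max_lt h2 (lt_of_le_of_lt (min_le_height h (opp hi)) (lt_of_le_of_ne (hmax (opp hi) hhi) ?_))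
      exact fun heq => opp_ne hi (hinj heq)
    obtain ⟨c1, hc1, hc1'⟩ := exists_between a1
    obtain ⟨c2, hc2, hc2'⟩ := exists_between a2
    rw [lt_min_iff] at hc1'
    rw [max_lt_iff] at hc2
    exact hI.out (hSI lo.1 hlo c1 ⟨lt_of_le_of_lt (min_le_height h lo) hc1, hc1'.2⟩)
      (hSI hi.1 hhi c2 ⟨hc2.2, lt_of_lt_of_le hc2' (height_le_max h hi)⟩) ⟨hc1'.1.le, hc2.1.le⟩
  by_contra hcon
  push Not at hcon
  have hsep : ∀ i ∉ S, (∀ b, h (i, b) ≤ h lo) ∨ ∀ b, h hi ≤ h (i, b) := by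
    intro i hiS
    by_contra hno
    push Not at hno
    obtain ⟨⟨b, hb⟩, ⟨b', hb'⟩⟩ := hno
    have : max (h lo) (min (h (i, true)) (h (i, false))) <
        min (h hi) (max (h (i, true)) (h (i, false))) := by
      rw [max_lt_iff, lt_min_iff, lt_min_iff]
      exact ⟨⟨hlohi, hb.trans_le (height_le_max h (i, b))⟩,
        (min_le_height h (i, b')).trans_lt hb', min_lt_max_of_injective hinj i⟩
    obtain ⟨c, hc, hc'⟩ := exists_between this
    rw [max_lt_iff] at hc
    rw [lt_min_iff] at hc'
    exact hcon i hiS c (hsub c hc.1 hc'.1) ⟨hc.2, hc'.2⟩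
  have hne : ∀ k l : Fin n × Bool, k.1 ∉ S → l.1 ∈ S → h k ≠ h l := by
    intro k l hk hl heq
    exact hk (hinj heq ▸ hl)
  -- First threshold, at the top of `S`: the labels above it form opposite pairs and do not include
  -- `hi`, so there are none.
  have htop : ∀ k, h k ≤ h hi := by
    refine (hl (h hi) fun k hk => ?_).resolve_left fun hall => lt_irrefl _ (hall hi)
    have hkS : k.1 ∉ S := fun hkS => absurd (hmax k hkS) (not_le.2 hk)
    rcases hsep k.1 hkS with hs | hs
    · exact absurd ((hs k.2).trans hlohi.le) (not_le.2 hk)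
    · exact lt_of_le_of_ne (hs (opp k).2) (hne (opp k) hi hkS hhi).symm
  have hbelow : ∀ k : Fin n × Bool, k.1 ∉ S → h k < h lo := by
    intro k hkS
    rcases hsep k.1 hkS with hs | hs
    · exact lt_of_le_of_ne (hs k.2) (hne k lo hkS hlo)
    · exact absurd (le_antisymm (htop k) (hs k.2)) (hne k hi hkS hhi)
  obtain ⟨i, hi'⟩ : ∃ i, i ∉ S := by
    by_contra hno
    push Not at hno
    exact hS' (Finset.eq_univ_iff_forall.2 hno)
  -- Second threshold, at the highest label outside `S`: exactly the labels over `S` lie above it,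
  -- which is neither every label nor none.
  obtain ⟨t, ht, htmax⟩ := Finset.exists_max_image (Finset.univ.filter fun k : Fin n × Bool => k.1 ∉ S) h
    ⟨(i, true), by simpa using hi'⟩
  simp only [Finset.mem_filter, Finset.mem_univ, true_and] at ht htmax
  rcases hl (h t) fun k hk => by
      have hkS : k.1 ∈ S := by
        by_contra hkS
        exact absurd (htmax k hkS) (not_le.2 hk)
      exact (hbelow t ht).trans_le (hmin (opp k) hkS) with hall | hall
  · exact lt_irrefl _ (hall t)
  · exact absurd (hall lo) (not_le.2 (hbelow t ht))

/-- Directions are added one at a time, in an order dictated by the heights. The first apex pair is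
placed over the single point `0`, of height `0`, which is why some direction must have `0` strictly
between its heights. -/
theorem HeightLinked.exists_crossPolytope {n : ℕ} {h : Fin n × Bool → ℝ} (hl : HeightLinked h)
    (hinj : Function.Injective h) {i₀ : Fin n} (h0 : StrictlyBetween h i₀ 0) :
    ∃ B : CrossPolytope h Finset.univ, ∀ i c, StrictlyBetween h i c → c ∈ coordSum n '' B.inner := by
  have key : ∀ m ≤ n, ∃ S : Finset (Fin n), S.card = m ∧ ∃ B : CrossPolytope h S,
      B.inner.Nonempty ∧ (S = ∅ → 0 ∈ B.inner) ∧
      ∀ i ∈ S, ∀ c, StrictlyBetween h i c → c ∈ coordSum n '' B.inner := by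
    intro m
    induction m with
    | zero =>
      intro _
      have := CrossPolytope.zero_mem_inner_point h
      exact ⟨∅, rfl, CrossPolytope.point h, ⟨_, this⟩, fun _ => this, by simp⟩
    | succ m ih =>
      intro hm
      obtain ⟨S, hcard, B, hBne, hB0, hB⟩ := ih (by omega)
      have hex : ∃ i ∉ S, ∃ c ∈ coordSum n '' B.inner, StrictlyBetween h i c := by
        rcases S.eq_empty_or_nonempty with rfl | hS
        · exact ⟨i₀, by simp, 0, ⟨0, hB0 rfl, by simp⟩, h0⟩
        · refine hl.exists_strictlyBetween hinj hS ?_ B.ordConnected_heights hB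
          rintro rfl
          simp at hcard
          omega
      obtain ⟨i, hi, _, ⟨ξ, hξ, rfl⟩, hc⟩ := hex
      refine ⟨insert i S, by rw [Finset.card_insert_of_notMem hi, hcard], B.bipyramid hi hξ hc,
        hBne.mono (B.inner_subset_inner_bipyramid hi hξ hc),
        fun h => absurd h (Finset.insert_ne_empty i S), fun j hj c hjc => ?_⟩
      rcases Finset.mem_insert.1 hj with rfl | hj
      · exact B.mem_heights_bipyramid hi hξ hc hjc
      · exact Set.image_mono (B.inner_subset_inner_bipyramid hi hξ hc) (hB j hj c hjc)
  obtain ⟨S, hcard, B, -, -, hB⟩ := key n le_rfl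
  obtain rfl : S = Finset.univ := Finset.card_eq_iff_eq_univ S |>.1 (by simpa using hcard)
  exact ⟨B, fun i => hB i (Finset.mem_univ i)⟩

/-! ### Polar duality and realization of shellings -/

/-- The polar dual of a cross-polytope with respect to an interior point. -/
noncomputable def CrossPolytope.dual {n : ℕ} {h : Fin n × Bool → ℝ} (B : CrossPolytope h Finset.univ)
    {o : Fin n → ℝ} (ho : o ∈ B.inner) : CubeSystem n :=
  -- The vertex for `s` is the gradient of `ψ s` divided by `-ψ s o`. Its pairing with `b k - o` is
  -- `1` where `ψ s` vanishes at `b k` and less than `1` where it is negative there.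
  have key : ∀ k s, ∑ j, (B.b k j - o j) * ((B.ψ s).linear (fun l => if j = l then 1 else 0) /
      -B.ψ s o) = (B.ψ s (B.b k) - B.ψ s o) / -B.ψ s o := by
    intro k s
    have h1 : (B.ψ s).linear (B.b k - o) = B.ψ s (B.b k) - B.ψ s o := (B.ψ s).linearMap_vsub _ _
    rw [LinearMap.pi_apply_eq_sum_univ] at h1
    rw [← h1, Finset.sum_div]
    refine Finset.sum_congr rfl fun j _ => ?_
    rw [smul_eq_mul, Pi.sub_apply, mul_div_assoc]
  { g := fun k => AffineMap.const ℝ _ 1 -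
      (∑ j, (B.b k j - o j) • (LinearMap.proj j : (Fin n → ℝ) →ₗ[ℝ] ℝ)).toAffineMap
    v := fun s j => (B.ψ s).linear (fun l => if j = l then 1 else 0) / -B.ψ s o
    g_self := fun s i => by
      simp only [AffineMap.coe_sub, AffineMap.coe_const, Pi.sub_apply, Function.const_apply,
        LinearMap.coe_toAffineMap, LinearMap.sum_apply, LinearMap.smul_apply, LinearMap.proj_apply,
        smul_eq_mul, key, B.ψ_self s i (Finset.mem_univ i)]
      have := (ho.2 s).ne
      field_simp
      ring
    g_not := fun s i => by
      simp only [AffineMap.coe_sub, AffineMap.coe_const, Pi.sub_apply, Function.const_apply,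
        LinearMap.coe_toAffineMap, LinearMap.sum_apply, LinearMap.smul_apply, LinearMap.proj_apply,
        smul_eq_mul, key]
      have h1 := ho.2 s
      have h2 := B.ψ_not s i (Finset.mem_univ i)
      rw [sub_pos, div_lt_one (by linarith)]
      linarith }

theorem CrossPolytope.dual_g_zero {n : ℕ} {h : Fin n × Bool → ℝ} (B : CrossPolytope h Finset.univ)
    {o : Fin n → ℝ} (ho : o ∈ B.inner) (k : Fin n × Bool) : (B.dual ho).g k 0 = 1 := by
  simp [CrossPolytope.dual]

theorem CrossPolytope.dual_linear_one {n : ℕ} {h : Fin n × Bool → ℝ}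
    (B : CrossPolytope h Finset.univ) {o : Fin n → ℝ} (ho : o ∈ B.inner) (k : Fin n × Bool) :
    ((B.dual ho).g k).linear 1 = coordSum n o - h k := by
  rw [← B.height k (Finset.mem_univ _), coordSum_apply, coordSum_apply]
  simp [CrossPolytope.dual]

/-- Inversion carries the decreasing order of the nonzero reals to the order of traversal through
infinity. -/
theorem metBefore_inv {u u' : ℝ} (hu : u ≠ 0) (hu' : u' ≠ 0) (h : u' < u) :
    MetBefore u⁻¹ u'⁻¹ := by
  rcases hu.lt_or_gt with h1 | h1
  · exact Or.inr ⟨mul_pos_of_neg_of_neg (inv_lt_zero.2 h1) (inv_lt_zero.2 (h.trans h1)),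
      (inv_lt_inv_of_neg h1 (h.trans h1)).2 h⟩
  · rcases hu'.lt_or_gt with h2 | h2
    · exact Or.inl ⟨inv_pos.2 h1, inv_lt_zero.2 h2⟩
    · exact Or.inr ⟨mul_pos (inv_pos.2 h1) (inv_pos.2 h2), (inv_lt_inv₀ h1 h2).2 h⟩

/-- In the dual polytope, the line through `0` in the all-ones direction meets the hyperplane of
label `k` at the inverse of the height of `k` measured from `o`. Decreasing heights therefore give
the crossing order. -/
theorem exists_system_of_heights {n : ℕ} (hn : 1 ≤ n) {h : Fin n × Bool → ℝ} (hl : HeightLinked h)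
    (hinj : Function.Injective h) {l : List (Fin n × Bool)} (hle : Enumerates Finset.univ l)
    (hsort : l.Pairwise fun k k' => h k' < h k) :
    ∃ S : CubeSystem n, (l.map fun k => S.face {k}) ∈ lineShellings (S.face ∅) := by
  let i₀ : Fin n := ⟨0, hn⟩
  -- Shifting all heights by `c₀` puts `0` strictly between the heights of direction `i₀` and keeps
  -- their order.
  obtain ⟨c₀, hc₀⟩ := exists_between (min_lt_max_of_injective hinj i₀)
  let h' : Fin n × Bool → ℝ := fun k => h k - c₀
  have hinj' : Function.Injective h' := fun k k' hk => hinj (by simpa [h'] using hk)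
  have hl' : HeightLinked h' := by
    intro t ht
    have := hl (t + c₀) fun k hk => by
      have := ht k (by simp only [h']; linarith)
      simp only [h'] at this
      linarith
    rcases this with h1 | h1
    · exact Or.inl fun k => by have := h1 k; simp only [h']; linarith
    · exact Or.inr fun k => by have := h1 k; simp only [h']; linarith
  have h0 : StrictlyBetween h' i₀ 0 := by
    simp only [StrictlyBetween, h', min_sub_sub_right, max_sub_sub_right]
    constructor <;> linarith [hc₀.1, hc₀.2]
  obtain ⟨B, hB⟩ := hl'.exists_crossPolytope hinj' h0
  -- The polar center is taken at a height different from that of every vertex, so that the line is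
  -- parallel to no facet hyperplane.
  obtain ⟨c, hc, hcne⟩ := ((Set.Ioo_infinite (min_lt_max_of_injective hinj' i₀)).sdiff
    (Set.finite_range h')).nonempty
  obtain ⟨o, ho, rfl⟩ := hB i₀ c hc
  have hne : ∀ k, h' k - coordSum n o ≠ 0 := fun k hk => hcne ⟨k, sub_eq_zero.1 hk⟩
  refine ⟨B.dual ho, 0, 1, (B.dual ho).isLineShellingAlong_iff.2 ⟨?_, l, hle, rfl, fun k => ?_, ?_⟩⟩
  · exact (B.dual ho).mem_interior_face_empty fun k => by rw [B.dual_g_zero ho]; exact one_pos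
  · rw [B.dual_linear_one ho, ← neg_sub]
    exact neg_ne_zero.2 (hne k)
  · refine hsort.imp fun {k k'} hkk' => ?_
    have hτ : ∀ k, -(B.dual ho).g k 0 / ((B.dual ho).g k).linear 1 = (h' k - coordSum n o)⁻¹ := by
      intro k
      rw [B.dual_g_zero ho, B.dual_linear_one ho, ← neg_sub, neg_div_neg_eq, one_div]
    rw [hτ, hτ]
    refine metBefore_inv (hne k) (hne k') ?_
    simp only [h']
    linarith

/-- With heights decreasing along the list, the labels above a threshold form an initial segment,
and every such segment arises this way. -/
theorem Linked.heightLinked {n : ℕ} {l : List (Fin n × Bool)} (hle : Enumerates Finset.univ l)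
    (hl : Linked l) : HeightLinked fun k => -(l.idxOf k : ℝ) := by
  intro t ht
  by_contra hcon
  push Not at hcon
  obtain ⟨⟨k₁, hk₁⟩, k₂, hk₂⟩ := hcon
  have hmem : ∀ k, k ∈ l.take ⌈-t⌉₊ ↔ t < -(l.idxOf k : ℝ) := by
    intro k
    have hk : k ∈ l := (hle.2 k).2 (Finset.mem_univ _)
    rw [List.mem_take_iff_idxOf_lt hk, Nat.lt_ceil, lt_neg]
  have hpos : 0 < ⌈-t⌉₊ := by
    have := (hmem k₂).2 hk₂
    rcases Nat.eq_zero_or_pos ⌈-t⌉₊ with h | h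
    · rw [h] at this; simp at this
    · exact h
  have hlt : ⌈-t⌉₊ < l.length := by
    have h1 : k₁ ∉ l.take ⌈-t⌉₊ := fun h => absurd ((hmem k₁).1 h) (not_lt.2 hk₁)
    by_contra h
    rw [List.take_of_length_le (not_lt.1 h)] at h1
    exact h1 ((hle.2 _).2 (Finset.mem_univ _))
  obtain ⟨k, hk, hk'⟩ := hl _ hpos hlt
  rw [hmem] at hk hk'
  exact hk' (ht k hk)

theorem cube_shelling_realizable {n : ℕ} (hn : 1 ≤ n) {L : List (Set (Fin n → ℝ))}
    (hL : L ∈ shellings (stdCube n)) : ∃ Q : Set (Fin n → ℝ), IsPolytope Q ∧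
      ∃ e : Face (stdCube n) ≃o Face Q, ∃ L' ∈ lineShellings Q, Corresponds e L L' := by
  rw [← stdSystem_face_empty] at hL ⊢
  obtain ⟨l, hle, hl, rfl⟩ := ((stdSystem n).isShelling_iff hn).1 hL
  obtain ⟨S, hS⟩ := exists_system_of_heights hn (hl.heightLinked hle) (l := l)
    (fun k k' h => by
      have h : l.idxOf k = l.idxOf k' := by simpa using h
      exact (List.idxOf_inj ((hle.2 k).2 (Finset.mem_univ _))).1 h) hle (by
      rw [List.pairwise_iff_getElem]
      intro i j hi hj hij
      rw [hle.1.idxOf_getElem, hle.1.idxOf_getElem, neg_lt_neg_iff]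
      exact_mod_cast hij)
  refine ⟨S.face ∅, S.isPolytope_face_empty, (stdSystem n).faceIso S hn, _, hS, ?_⟩
  rw [Corresponds, List.forall₂_map_left_iff, List.forall₂_map_right_iff, List.forall₂_same]
  intro k _
  exact ⟨(stdSystem n).isExposed_face (Set.empty_subset _),
    (stdSystem n).faceIso_face_singleton S hn k _⟩

/-! ### The valid order arrangement at the center -/

section VisibilityOfCube

variable {n : ℕ}

/-- The affine span of the facet of the cube labelled `k`. -/
def facetSpan (k : Fin n × Bool) : AffineSubspace ℝ (Fin n → ℝ) :=
  affineSpan ℝ ((stdSystem n).face {k})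

theorem mem_facetSpan {k : Fin n × Bool} {x : Fin n → ℝ} :
    x ∈ facetSpan k ↔ x k.1 = if k.2 then 1 else 0 := by
  rw [facetSpan, CubeSystem.mem_affineSpan_face_iff]
  rcases k with ⟨i, b⟩
  cases b
  · simp [stdSystem_g_false]
  · rw [stdSystem_g_true, sub_eq_zero, eq_comm]; simp

theorem visArrangement_stdCube : visArrangement (stdCube n) = Set.range facetSpan := by
  ext H
  rw [← stdSystem_face_empty]
  simp only [visArrangement, Set.mem_ofPred_eq, CubeSystem.isFacet_face_empty_iff, Set.mem_range,
    facetSpan]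
  constructor
  · rintro ⟨_, ⟨k, rfl⟩, rfl⟩; exact ⟨k, rfl⟩
  · rintro ⟨k, rfl⟩; exact ⟨_, ⟨k, rfl⟩, rfl⟩

theorem mem_direction_facetSpan {k : Fin n × Bool} {x : Fin n → ℝ} :
    x ∈ (facetSpan k).direction ↔ x k.1 = 0 := by
  have h : (fun _ => if k.2 then 1 else 0 : Fin n → ℝ) ∈ facetSpan k := mem_facetSpan.2 rfl
  rw [← AffineSubspace.vadd_mem_iff_mem_direction x h, mem_facetSpan]
  simp

theorem facetSpan_parallel_iff {k l : Fin n × Bool} :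
    (facetSpan k).Parallel (facetSpan l) ↔ k.1 = l.1 := by
  have hne : ∀ k : Fin n × Bool, facetSpan k ≠ ⊥ := by
    intro k h
    have : (fun _ => if k.2 then 1 else 0 : Fin n → ℝ) ∈ facetSpan k := mem_facetSpan.2 rfl
    rw [h] at this
    exact AffineSubspace.notMem_bot ℝ _ _ this
  rw [AffineSubspace.parallel_iff_direction_eq_and_eq_bot_iff_eq_bot]
  simp only [hne, and_true]
  constructor
  · intro h
    by_contra hkl
    have h1 : (Pi.single k.1 1 : Fin n → ℝ) ∈ (facetSpan l).direction :=
      mem_direction_facetSpan.2 (by simp [Ne.symm hkl])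
    rw [← h, mem_direction_facetSpan] at h1
    simp at h1
  · intro h
    ext x
    rw [mem_direction_facetSpan, mem_direction_facetSpan, h]

/-- About the center the intersection has `i`-th and `j`-th coordinates `±1/2`, so its span with the
center is a hyperplane `xᵢ = ± xⱼ`, the sign telling whether the two labels agree. -/
theorem mem_affineSpan_insert_cubeCenter {i j : Fin n} (hij : i ≠ j) {b c : Bool} {x : Fin n → ℝ} :
    x ∈ affineSpan ℝ (insert (cubeCenter n)
      ((facetSpan (i, b) : Set (Fin n → ℝ)) ∩ (facetSpan (j, c) : Set (Fin n → ℝ)))) ↔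
      x i - 1 / 2 = (if b = c then 1 else -1) * (x j - 1 / 2) := by
  constructor
  · intro hx
    let f : (Fin n → ℝ) →ₗ[ℝ] ℝ := LinearMap.proj i - (if b = c then 1 else -1 : ℝ) • LinearMap.proj j
    have hf : ∀ y, f y = y i - (if b = c then 1 else -1) * y j := fun y => by
      simp only [f, LinearMap.sub_apply, LinearMap.smul_apply, LinearMap.proj_apply, smul_eq_mul]
    have hle : affineSpan ℝ (insert (cubeCenter n)
      ((facetSpan (i, b) : Set (Fin n → ℝ)) ∩ (facetSpan (j, c) : Set (Fin n → ℝ)))) ≤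
        AffineSubspace.mk' (cubeCenter n) (LinearMap.ker f) := by
      rw [affineSpan_le]
      rintro y (rfl | ⟨h1, h2⟩)
      · exact AffineSubspace.self_mem_mk' _ _
      · rw [SetLike.mem_coe, mem_facetSpan] at h1 h2
        rw [SetLike.mem_coe, AffineSubspace.mem_mk', LinearMap.mem_ker, hf]
        simp only [vsub_eq_sub, Pi.sub_apply, h1, h2, cubeCenter]
        cases b <;> cases c <;> norm_num
    have := hle hx
    rw [AffineSubspace.mem_mk', LinearMap.mem_ker, hf, vsub_eq_sub, Pi.sub_apply, Pi.sub_apply] at this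
    simp only [cubeCenter] at this
    linarith
  · intro hx
    set K := affineSpan ℝ (insert (cubeCenter n)
      ((facetSpan (i, b) : Set (Fin n → ℝ)) ∩ (facetSpan (j, c) : Set (Fin n → ℝ)))) with hK
    have hp : cubeCenter n ∈ K := subset_affineSpan ℝ _ (Set.mem_insert _ _)
    have hmem : ∀ y : Fin n → ℝ, y i = (if b then 1 else 0) → y j = (if c then 1 else 0) → y ∈ K :=
      fun y h1 h2 => subset_affineSpan ℝ _ (Set.mem_insert_of_mem _ ⟨mem_facetSpan.2 h1, mem_facetSpan.2 h2⟩)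
    let y' : Fin n → ℝ := Function.update (fun _ => if c then 1 else 0) i (if b then 1 else 0)
    have hy'i : y' i = if b then 1 else 0 := by simp [y']
    have hy'j : y' j = if c then 1 else 0 := by simp [y', hij.symm]
    -- With this `t`, the point at parameter `t` on the line from the center to `y'` agrees with `x`
    -- in coordinates `i` and `j`. The remaining difference `y - y'` is a direction of the
    -- intersection.
    let t : ℝ := (if b then 2 else -2) * (x i - 1 / 2)
    let y : Fin n → ℝ := y' + (x - cubeCenter n) - t • (y' - cubeCenter n)
    have hy : y ∈ K := by
      apply hmem
      · simp only [y, t, Pi.sub_apply, Pi.add_apply, Pi.smul_apply, smul_eq_mul, hy'i, cubeCenter]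
        cases b <;> simp <;> ring
      · simp only [y, t, Pi.sub_apply, Pi.add_apply, Pi.smul_apply, smul_eq_mul, hy'j, cubeCenter, hx]
        cases b <;> cases c <;> simp <;> ring
    have hy' : y' ∈ K := hmem y' hy'i hy'j
    have h1 : AffineMap.lineMap (cubeCenter n) y' t ∈ K := AffineMap.lineMap_mem t hp hy'
    have h2 := AffineSubspace.vadd_mem_of_mem_direction (AffineSubspace.vsub_mem_direction hy hy') h1
    convert h2 using 1
    simp only [AffineMap.lineMap_apply, vsub_eq_sub, vadd_eq_add, y]
    abel

theorem validOrderArrangement_stdCube :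
    validOrderArrangement (visArrangement (stdCube n)) (cubeCenter n) =
      (fun W => AffineSubspace.mk' (cubeCenter n) W) '' coxeterB n := by
  rw [visArrangement_stdCube]
  have hpair : ∀ i j : Fin n, i < j → ∀ b c : Bool, ∃ W ∈ coxeterB n,
      AffineSubspace.mk' (cubeCenter n) W = affineSpan ℝ (insert (cubeCenter n)
      ((facetSpan (i, b) : Set (Fin n → ℝ)) ∩ (facetSpan (j, c) : Set (Fin n → ℝ)))) := by
    intro i j hij b c
    set K := affineSpan ℝ (insert (cubeCenter n)
      ((facetSpan (i, b) : Set (Fin n → ℝ)) ∩ (facetSpan (j, c) : Set (Fin n → ℝ)))) with hK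
    have hp : cubeCenter n ∈ K := subset_affineSpan ℝ _ (Set.mem_insert _ _)
    refine ⟨K.direction, ?_, AffineSubspace.mk'_eq hp⟩
    have hmem : ∀ x, x ∈ K.direction ↔ x i = (if b = c then 1 else -1) * x j := by
      intro x
      rw [← AffineSubspace.vadd_mem_iff_mem_direction x hp, mem_affineSpan_insert_cubeCenter hij.ne]
      simp [cubeCenter]
    by_cases hbc : b = c
    · exact Or.inl (Or.inr ⟨i, j, hij, fun x => by rw [hmem]; simp [hbc]⟩)
    · exact Or.inr ⟨i, j, hij, fun x => by rw [hmem]; simp [hbc]⟩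
  ext K
  constructor
  · rintro (⟨_, ⟨⟨i, b⟩, rfl⟩, _, ⟨⟨j, c⟩, rfl⟩, hpar, rfl⟩ | ⟨_, ⟨k, rfl⟩, _, ⟨l, rfl⟩, -, -, rfl⟩)
    · rw [facetSpan_parallel_iff] at hpar
      rcases lt_or_gt_of_ne hpar with hij | hij
      · exact hpair i j hij b c
      · rw [Set.inter_comm]
        exact hpair j i hij c b
    · exact ⟨_, Or.inl (Or.inl ⟨k.1, fun x => mem_direction_facetSpan⟩), rfl⟩
  · have hK : ∀ W : Submodule ℝ (Fin n → ℝ), ∀ i j : Fin n, i < j → ∀ b : Bool,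
        (∀ x, x ∈ W ↔ x i = (if b then 1 else -1) * x j) → AffineSubspace.mk' (cubeCenter n) W ∈
        validOrderArrangement (Set.range facetSpan) (cubeCenter n) := by
      intro W i j hij b hW
      refine Or.inl ⟨_, ⟨(i, true), rfl⟩, _, ⟨(j, b), rfl⟩, ?_, ?_⟩
      · rw [facetSpan_parallel_iff]; exact hij.ne
      · ext x
        rw [AffineSubspace.mem_mk', hW, mem_affineSpan_insert_cubeCenter hij.ne]
        simp [cubeCenter, eq_comm]
    rintro ⟨W, (⟨i, hW⟩ | ⟨i, j, hij, hW⟩) | ⟨i, j, hij, hW⟩, rfl⟩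
    · refine Or.inr ⟨_, ⟨(i, true), rfl⟩, _, ⟨(i, false), rfl⟩, fun h => ?_,
        facetSpan_parallel_iff.2 rfl, congrArg _ ?_⟩
      · have h1 : (fun _ => 1 : Fin n → ℝ) ∈ facetSpan (i, true) := mem_facetSpan.2 rfl
        rw [h, mem_facetSpan] at h1
        simp at h1
      · ext x
        rw [hW, mem_direction_facetSpan]
    · exact hK W i j hij true fun x => by simp [hW]
    · exact hK W i j hij false fun x => by simp [hW]

end VisibilityOfCube

/-! ### Characteristic polynomials by counting points -/

section PointCounting

variable {E : Type*} [NormedAddCommGroup E] [NormedSpace ℝ E]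

open Classical in
/-- The characteristic polynomial counts the points of a set off the hyperplanes, if the set meets
every flat of dimension `d` in `q ^ d` points. -/
theorem eval_arrangementCharPoly {A : Set (AffineSubspace ℝ E)} (hA : A.Finite) (htop : ⊤ ∉ A)
    (Z : Finset E) (q : ℤ) (hZ : ∀ Y ∈ intersectionSet A,
      ((Z.filter (· ∈ Y)).card : ℤ) = q ^ Module.finrank ℝ Y.direction) :
    (arrangementCharPoly A).eval q = ((Z.filter fun z => ∀ H ∈ A, z ∉ H).card : ℤ) := by
  let _ : Finite (IntersectionPoset A) := intersectionPoset_finite hA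
  let _ : Fintype (IntersectionPoset A) := Fintype.ofFinite _
  let _ : LocallyFiniteOrder (IntersectionPoset A) := Fintype.toLocallyFiniteOrder
  have hflat : ∀ z : E, sInf {H ∈ A | z ∈ H} ∈ intersectionSet A := by
    intro z
    refine ⟨fun h => ?_, _, Set.sep_subset _ _, rfl⟩
    have hz : z ∈ sInf {H ∈ A | z ∈ H} := by
      rw [AffineSubspace.mem_sInf_iff]
      exact fun H hH => hH.2
    rw [h] at hz
    exact AffineSubspace.notMem_bot ℝ _ _ hz
  let flat : E → IntersectionPoset A := fun z => OrderDual.toDual ⟨_, hflat z⟩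
  -- The intersection of the hyperplanes through `z` is the smallest flat containing `z`, so the
  -- flats through `z` form an interval starting at the whole space.
  have hmem : ∀ z (Y : IntersectionPoset A), z ∈ (OrderDual.ofDual Y).1 ↔ Y ≤ flat z := by
    intro z Y
    have hle : Y ≤ flat z ↔ sInf {H ∈ A | z ∈ H} ≤ (OrderDual.ofDual Y).1 := Iff.rfl
    rw [hle]
    constructor
    · intro hz
      obtain ⟨-, B, hB, hY⟩ := (OrderDual.ofDual Y).2
      rw [hY] at hz ⊢
      rw [AffineSubspace.mem_sInf_iff] at hz
      exact sInf_le_sInf fun H hH => ⟨hB hH, hz H hH⟩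
    · intro h
      apply h
      rw [AffineSubspace.mem_sInf_iff]
      exact fun H hH => hH.2
  have hwhole : ∀ Y : IntersectionPoset A, IntersectionPoset.whole A ≤ Y := fun Y =>
    show (OrderDual.ofDual Y).1 ≤ (⊤ : AffineSubspace ℝ E) from le_top
  have hsum : ∀ z, ∑ Y : IntersectionPoset A, (if z ∈ (OrderDual.ofDual Y).1 then
      IncidenceAlgebra.mu ℤ (IntersectionPoset.whole A) Y else 0) =
      if ∀ H ∈ A, z ∉ H then 1 else 0 := by
    intro z
    rw [← Finset.sum_filter]
    have h1 : (Finset.univ.filter fun Y : IntersectionPoset A => z ∈ (OrderDual.ofDual Y).1) =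
        Finset.Icc (IntersectionPoset.whole A) (flat z) := by
      ext Y
      simp [hmem, hwhole]
    have h2 : IntersectionPoset.whole A = flat z ↔ ∀ H ∈ A, z ∉ H := by
      have : IntersectionPoset.whole A = flat z ↔ (⊤ : AffineSubspace ℝ E) = sInf {H ∈ A | z ∈ H} :=
        ⟨fun h => congrArg (fun Y => (OrderDual.ofDual Y).1) h, fun h => Subtype.ext h⟩
      rw [this, eq_comm, sInf_eq_top]
      exact ⟨fun h H hH hz => htop (h H ⟨hH, hz⟩ ▸ hH), fun h H hH => absurd hH.2 (h H hH.1)⟩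
    rw [h1, IncidenceAlgebra.sum_Icc_mu_right]
    simp only [h2]
  have heval : (arrangementCharPoly A).eval q = ∑ Y : IntersectionPoset A,
      IncidenceAlgebra.mu ℤ (IntersectionPoset.whole A) Y *
        q ^ Module.finrank ℝ (OrderDual.ofDual Y).1.direction := by
    rw [arrangementCharPoly, dif_pos hA, moebiusPoly, eval_finsetSum]
    simp
  rw [heval]
  -- Write each power of `q` as a count of points and exchange the sums. For fixed `z` the Möbius
  -- values over its interval sum to `1` if `z` is off all hyperplanes and to `0` otherwise.
  calc _ = ∑ Y : IntersectionPoset A, ∑ z ∈ Z, (if z ∈ (OrderDual.ofDual Y).1 then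
      IncidenceAlgebra.mu ℤ (IntersectionPoset.whole A) Y else 0) := by
        refine Finset.sum_congr rfl fun Y _ => ?_
        rw [← hZ _ (OrderDual.ofDual Y).2, Finset.card_filter, Nat.cast_sum, Finset.mul_sum]
        refine Finset.sum_congr rfl fun z _ => ?_
        split_ifs <;> simp
    _ = _ := by
        rw [Finset.sum_comm, Finset.card_filter, Nat.cast_sum]
        refine Finset.sum_congr rfl fun z _ => ?_
        rw [hsum]
        split_ifs <;> simp

end PointCounting

/-! ### Flats of the type B arrangement and lattice points -/

section CoxeterB

variable {n : ℕ}

/-- `σ` is `0`, or `1` or `-1` and `j` belongs to `J`. -/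
def SignAt (J : Finset (Fin n)) (j : Fin n) (σ : ℝ) : Prop := σ = 0 ∨ j ∈ J ∧ (σ = 1 ∨ σ = -1)

/-- The coordinates in `J` are independent on `V`, and every other coordinate is zero or agrees up to
sign with one of them. -/
structure IsSignedBasis (V : Submodule ℝ (Fin n → ℝ)) (J : Finset (Fin n)) : Prop where
  coord : ∀ i, ∃ j σ, SignAt J j σ ∧ ∀ x ∈ V, x i = σ * x j
  surj : ∀ u : Fin n → ℝ, ∃ x ∈ V, ∀ j ∈ J, x j = u j

theorem isSignedBasis_top : IsSignedBasis (⊤ : Submodule ℝ (Fin n → ℝ)) Finset.univ where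
  coord i := ⟨i, 1, Or.inr ⟨Finset.mem_univ _, Or.inl rfl⟩, fun _ _ => (one_mul _).symm⟩
  surj u := ⟨u, trivial, fun _ _ => rfl⟩

theorem IsSignedBasis.of_coord_eq {V V' : Submodule ℝ (Fin n → ℝ)} {J : Finset (Fin n)}
    (hV : IsSignedBasis V J) {a b : Fin n} {σ : ℝ} (ha : a ∈ J) (hb : SignAt (J.erase a) b σ)
    (hV' : ∀ x, x ∈ V' ↔ x ∈ V ∧ x a = σ * x b) : IsSignedBasis V' (J.erase a) where
  coord i := by
    obtain ⟨j, τ, hτ, h⟩ := hV.coord i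
    by_cases hja : j = a
    · subst hja
      refine ⟨b, τ * σ, ?_, fun x hx => ?_⟩
      · rcases hτ with rfl | ⟨-, hτ⟩
        · exact Or.inl (zero_mul _)
        · rcases hb with rfl | ⟨hb, hσ⟩
          · exact Or.inl (mul_zero _)
          · refine Or.inr ⟨hb, ?_⟩
            rcases hτ with rfl | rfl <;> rcases hσ with rfl | rfl <;> norm_num
      · rw [hV'] at hx
        rw [h x hx.1, hx.2, mul_assoc]
    · refine ⟨j, τ, ?_, fun x hx => h x ((hV' x).1 hx).1⟩
      rcases hτ with rfl | ⟨hj, hτ⟩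
      · exact Or.inl rfl
      · exact Or.inr ⟨Finset.mem_erase.2 ⟨hja, hj⟩, hτ⟩
  surj u := by
    obtain ⟨x, hx, hxu⟩ := hV.surj (Function.update u a (σ * u b))
    refine ⟨x, (hV' x).2 ⟨hx, ?_⟩, fun j hj => ?_⟩
    · rw [hxu a ha, Function.update_self]
      rcases hb with rfl | ⟨hb, -⟩
      · simp
      · rw [Finset.mem_erase] at hb
        rw [hxu b hb.2, Function.update_of_ne hb.1]
    · rw [Finset.mem_erase] at hj
      rw [hxu j hj.2, Function.update_of_ne hj.1]

/-- Expressed in basis coordinates, the new equation is trivial, kills one basis coordinate, or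
identifies two of them up to sign. All coefficients stay in `{0, 1, -1}`, which is what makes the
lattice point count exact. -/
theorem IsSignedBasis.exists_inf {V V' : Submodule ℝ (Fin n → ℝ)} {J : Finset (Fin n)}
    (hV : IsSignedBasis V J) {i j : Fin n} {ρ : ℝ} (hρ : ρ = 0 ∨ ρ = 1 ∨ ρ = -1)
    (hV' : ∀ x, x ∈ V' ↔ x ∈ V ∧ x i = ρ * x j) : ∃ J', IsSignedBasis V' J' := by
  obtain ⟨a, σ, hσ, ha⟩ := hV.coord i
  obtain ⟨b, τ, hτ, hb⟩ := hV.coord j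
  have hτ' : SignAt J b (ρ * τ) := by
    rcases hτ with rfl | ⟨hbJ, hτ⟩
    · exact Or.inl (mul_zero _)
    · rcases hρ with rfl | rfl | rfl
      · exact Or.inl (zero_mul _)
      · exact Or.inr ⟨hbJ, by rwa [one_mul]⟩
      · exact Or.inr ⟨hbJ, by rcases hτ with rfl | rfl <;> norm_num⟩
  have hmem : ∀ x, x ∈ V' ↔ x ∈ V ∧ σ * x a = ρ * τ * x b := by
    intro x
    rw [hV']
    refine and_congr_right fun hx => ?_
    rw [ha x hx, hb x hx, mul_assoc]
  generalize ρ * τ = κ at hτ' hmem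
  have hzero : ∀ c ∈ J, (∀ x, x ∈ V' ↔ x ∈ V ∧ x c = 0) → ∃ J', IsSignedBasis V' J' :=
    fun c hc h => ⟨_, hV.of_coord_eq (b := c) (σ := 0) hc (Or.inl rfl) (by simpa using h)⟩
  have htriv : (∀ x, x ∈ V' ↔ x ∈ V) → ∃ J', IsSignedBasis V' J' := by
    intro h
    obtain rfl : V' = V := Submodule.ext h
    exact ⟨J, hV⟩
  rcases hσ with rfl | ⟨haJ, hσ⟩
  · rcases hτ' with rfl | ⟨hbJ, hκ⟩
    · exact htriv (by simpa using hmem)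
    · refine hzero b hbJ fun x => ?_
      rw [hmem, zero_mul, eq_comm (a := (0 : ℝ)), mul_eq_zero, or_iff_right]
      rcases hκ with rfl | rfl <;> norm_num
  · have hσ2 : σ * σ = 1 := by rcases hσ with rfl | rfl <;> norm_num
    have hsolve : ∀ x : Fin n → ℝ, σ * x a = κ * x b ↔ x a = σ * κ * x b := by
      intro x
      constructor
      · intro h
        rw [mul_assoc, ← h, ← mul_assoc, hσ2, one_mul]
      · intro h
        rw [h, ← mul_assoc, ← mul_assoc, hσ2, one_mul]
    simp only [hsolve] at hmem
    rcases hτ' with rfl | ⟨hbJ, hκ⟩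
    · exact hzero a haJ (by simpa using hmem)
    · have hsign : σ * κ = 1 ∨ σ * κ = -1 := by
        rcases hσ with rfl | rfl <;> rcases hκ with rfl | rfl <;> norm_num
      by_cases hab : b = a
      · subst hab
        rcases hsign with h | h
        · exact htriv (by simpa [h] using hmem)
        · refine hzero b haJ fun x => ?_
          rw [hmem, h]
          exact and_congr_right fun _ => ⟨fun h => by linarith, fun h => by rw [h]; simp⟩
      · exact ⟨_, hV.of_coord_eq haJ (Or.inr ⟨Finset.mem_erase.2 ⟨hab, hbJ⟩, hsign⟩) hmem⟩

theorem IsSignedBasis.finrank_eq {V : Submodule ℝ (Fin n → ℝ)} {J : Finset (Fin n)}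
    (hV : IsSignedBasis V J) : Module.finrank ℝ V = J.card := by
  let f : V →ₗ[ℝ] (J → ℝ) := (LinearMap.funLeft ℝ ℝ (Subtype.val : J → Fin n)).comp V.subtype
  have hf : Function.Bijective f := by
    constructor
    · rw [← LinearMap.ker_eq_bot, LinearMap.ker_eq_bot']
      intro x hx
      have hJ : ∀ j ∈ J, x.1 j = 0 := fun j hj => congrFun hx ⟨j, hj⟩
      apply Subtype.ext
      funext i
      obtain ⟨j, σ, hσ, h⟩ := hV.coord i
      rw [h x.1 x.2]
      rcases hσ with rfl | ⟨hj, -⟩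
      · simp
      · simp [hJ j hj]
    · intro w
      obtain ⟨x, hx, hxu⟩ := hV.surj fun j => if h : j ∈ J then w ⟨j, h⟩ else 0
      refine ⟨⟨x, hx⟩, funext fun j => ?_⟩
      exact (hxu j.1 j.2).trans (by simp)
  rw [(LinearEquiv.ofBijective f hf).finrank_eq]
  simp

/-- The integer points with coordinates between `-m` and `m`. -/
noncomputable def intBox (n m : ℕ) : Finset (Fin n → ℤ) := Fintype.piFinset fun _ => Finset.Icc (-(m : ℤ)) m

theorem mem_intBox {m : ℕ} {z : Fin n → ℤ} : z ∈ intBox n m ↔ ∀ i, |z i| ≤ m := by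
  simp [intBox, abs_le]

-- Restriction to the coordinates in `J` is a bijection onto the box there: the other coordinates
-- are zero or signed copies, hence integral and within the same bounds.
open Classical in
theorem IsSignedBasis.card_intBox {V : Submodule ℝ (Fin n → ℝ)} {J : Finset (Fin n)}
    (hV : IsSignedBasis V J) (m : ℕ) :
    ((intBox n m).filter fun z => (fun i => (z i : ℝ)) ∈ V).card = (2 * m + 1) ^ J.card := by
  have hcard : (Fintype.piFinset fun _ : J => Finset.Icc (-(m : ℤ)) m).card = (2 * m + 1) ^ J.card := by
    have : ((m : ℤ) + 1 + m).toNat = 2 * m + 1 := by omega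
    simp [Fintype.card_piFinset, this]
  rw [← hcard]
  refine Finset.card_nbij (fun z j => z j.1) ?_ ?_ ?_
  · intro z hz
    simp only [Finset.mem_filter, mem_intBox, abs_le, Finset.mem_coe] at hz
    simp only [Finset.mem_coe, Fintype.mem_piFinset, Finset.mem_Icc]
    exact fun j => hz.1 j
  · intro z hz z' hz' heq
    simp only [Finset.mem_filter, Finset.mem_coe] at hz hz'
    funext i
    obtain ⟨j, σ, hσ, h⟩ := hV.coord i
    have h1 := h _ hz.2
    have h2 := h _ hz'.2
    have : (z i : ℝ) = z' i := by
      rcases hσ with rfl | ⟨hj, -⟩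
      · rw [h1, h2]; simp
      · rw [h1, h2]
        have : z j = z' j := congrFun heq ⟨j, hj⟩
        rw [this]
    exact_mod_cast this
  · intro w hw
    simp only [Finset.mem_coe, Fintype.mem_piFinset, Finset.mem_Icc] at hw
    obtain ⟨x, hx, hxu⟩ := hV.surj fun j => if h : j ∈ J then (w ⟨j, h⟩ : ℝ) else 0
    have hint : ∀ i, ∃ a : ℤ, |a| ≤ m ∧ (a : ℝ) = x i := by
      intro i
      obtain ⟨j, σ, hσ, h⟩ := hV.coord i
      rw [h x hx]
      rcases hσ with rfl | ⟨hj, hσ⟩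
      · exact ⟨0, by simp, by simp⟩
      · have h1 : x j = w ⟨j, hj⟩ := by rw [hxu j hj]; simp [hj]
        have h2 := hw ⟨j, hj⟩
        rw [h1]
        rcases hσ with rfl | rfl
        · exact ⟨w ⟨j, hj⟩, abs_le.2 h2, by simp⟩
        · exact ⟨-w ⟨j, hj⟩, by rw [abs_neg]; exact abs_le.2 h2, by simp⟩
    choose z hz hzx using hint
    refine ⟨z, ?_, funext fun j => ?_⟩
    · simp only [Finset.mem_coe, Finset.mem_filter, mem_intBox, hzx]
      exact ⟨hz, hx⟩
    · have h1 := hzx j.1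
      rw [hxu j.1 j.2] at h1
      simp only [j.2, dif_pos] at h1
      exact_mod_cast h1

theorem mem_coxeterB_iff_exists {W : Submodule ℝ (Fin n → ℝ)} (hW : W ∈ coxeterB n) :
    ∃ i j ρ, (ρ = 0 ∨ ρ = 1 ∨ ρ = -1) ∧ ∀ x, x ∈ W ↔ x i = ρ * x j := by
  rcases hW with (⟨i, h⟩ | ⟨i, j, -, h⟩) | ⟨i, j, -, h⟩
  · exact ⟨i, i, 0, by simp, by simpa using h⟩
  · exact ⟨i, j, 1, by simp, by simpa using h⟩
  · exact ⟨i, j, -1, by simp, by simpa using h⟩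

theorem coxeterB_finite : (coxeterB n).Finite := by
  have hsub : coxeterB n ⊆ Set.range fun t : Fin n × Fin n × Fin 3 =>
      LinearMap.ker ((LinearMap.proj t.1 : (Fin n → ℝ) →ₗ[ℝ] ℝ) -
        ((t.2.2 : ℕ) - 1 : ℝ) • LinearMap.proj t.2.1) := by
    intro W hW
    obtain ⟨i, j, ρ, hρ, h⟩ := mem_coxeterB_iff_exists hW
    have : ∃ t : Fin 3, ((t : ℕ) - 1 : ℝ) = ρ := by
      rcases hρ with rfl | rfl | rfl
      · exact ⟨1, by norm_num⟩
      · exact ⟨2, by norm_num⟩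
      · exact ⟨0, by norm_num⟩
    obtain ⟨t, ht⟩ := this
    refine ⟨(i, j, t), ?_⟩
    ext x
    rw [h, LinearMap.mem_ker]
    simp [ht, sub_eq_zero]
  exact (Set.finite_range _).subset hsub

theorem top_notMem_coxeterB : (⊤ : Submodule ℝ (Fin n → ℝ)) ∉ coxeterB n := by
  rintro ((⟨i, h⟩ | ⟨i, j, hij, h⟩) | ⟨i, j, hij, h⟩)
  · have := (h 1).1 trivial
    simp at this
  · have := (h (Pi.single i 1)).1 trivial
    simp [hij.ne'] at this
  · have := (h (Pi.single i 1)).1 trivial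
    simp [hij.ne'] at this

theorem exists_isSignedBasis_of_subset {p : Fin n → ℝ} {B : Set (AffineSubspace ℝ (Fin n → ℝ))}
    (hB : B ⊆ (fun W => AffineSubspace.mk' p W) '' coxeterB n) :
    ∃ V J, IsSignedBasis V J ∧ sInf B = AffineSubspace.mk' p V := by
  have hfin : B.Finite := (coxeterB_finite.image _).subset hB
  induction B, hfin using Set.Finite.induction_on with
  | empty =>
    refine ⟨⊤, _, isSignedBasis_top, ?_⟩
    ext x
    simp
  | @insert H B _ _ ih =>
    obtain ⟨V, J, hV, hVB⟩ := ih ((Set.subset_insert _ _).trans hB)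
    obtain ⟨W, hW, rfl⟩ := hB (Set.mem_insert H B)
    obtain ⟨i, j, ρ, hρ, h⟩ := mem_coxeterB_iff_exists hW
    obtain ⟨J', hJ'⟩ := hV.exists_inf (V' := V ⊓ W) hρ fun x => by rw [Submodule.mem_inf, h]
    refine ⟨V ⊓ W, J', hJ', ?_⟩
    ext x
    rw [sInf_insert, hVB]
    simp only [AffineSubspace.mem_inf_iff, AffineSubspace.mem_mk', Submodule.mem_inf]
    exact and_comm

theorem signed_abs (b : Bool) {a : ℕ} :
    |(if b then 1 else -1 : ℤ) * ((a : ℤ) + 1)| = (a : ℤ) + 1 := by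
  have : (0 : ℤ) ≤ (a : ℤ) + 1 := by positivity
  rw [abs_mul, abs_of_nonneg this]
  cases b <;> simp

-- A box point avoids all hyperplanes iff its coordinates are nonzero with distinct absolute values.
-- Such a point is a choice of signs together with an injection of the directions into `{1, …, m}`.
open Classical in
theorem card_intBox_off_coxeterB (m : ℕ) :
    ((intBox n m).filter fun z => ∀ W ∈ coxeterB n, (fun i => (z i : ℝ)) ∉ W).card =
      2 ^ n * m.descFactorial n := by
  have hiff : ∀ z : Fin n → ℤ, (∀ W ∈ coxeterB n, (fun i => (z i : ℝ)) ∉ W) ↔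
      (∀ i, z i ≠ 0) ∧ Function.Injective fun i => |z i| := by
    intro z
    constructor
    · intro h
      have hlt : ∀ i j, i < j → |z i| ≠ |z j| := by
        intro i j hij habs
        rcases abs_eq_abs.1 habs with h1 | h1
        · refine h (LinearMap.ker ((LinearMap.proj i : (Fin n → ℝ) →ₗ[ℝ] ℝ) - LinearMap.proj j))
            (Or.inl (Or.inr ⟨i, j, hij, fun x => by simp [LinearMap.mem_ker, sub_eq_zero]⟩)) ?_
          simp [LinearMap.mem_ker, h1]
        · refine h (LinearMap.ker ((LinearMap.proj i : (Fin n → ℝ) →ₗ[ℝ] ℝ) + LinearMap.proj j))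
            (Or.inr ⟨i, j, hij, fun x => by simp [LinearMap.mem_ker, add_eq_zero_iff_eq_neg]⟩) ?_
          simp [LinearMap.mem_ker, h1]
      refine ⟨fun i hi => ?_, fun i j hij => ?_⟩
      · refine h (LinearMap.ker (LinearMap.proj i : (Fin n → ℝ) →ₗ[ℝ] ℝ))
          (Or.inl (Or.inl ⟨i, fun x => by simp [LinearMap.mem_ker]⟩)) ?_
        simp [LinearMap.mem_ker, hi]
      · by_contra hne
        rcases lt_or_gt_of_ne hne with h1 | h1
        · exact hlt i j h1 hij
        · exact hlt j i h1 hij.symm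
    · rintro ⟨h0, hinj⟩ W ((⟨i, h⟩ | ⟨i, j, hij, h⟩) | ⟨i, j, hij, h⟩) hz
      · exact h0 i (by exact_mod_cast (h _).1 hz)
      · have : z i = z j := by exact_mod_cast (h _).1 hz
        exact hij.ne (hinj (by simp [this]))
      · have : z i = -z j := by exact_mod_cast (h _).1 hz
        exact hij.ne (hinj (by simp [this]))
  let f : (Fin n → Bool) × (Fin n ↪ Fin m) → Fin n → ℤ := fun t i =>
    (if t.1 i then 1 else -1) * (((t.2 i : ℕ) : ℤ) + 1)
  have hf : Function.Injective f := by
    rintro ⟨s, e⟩ ⟨s', e'⟩ h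
    have he : ∀ i, e i = e' i := by
      intro i
      have := congrArg abs (congrFun h i)
      simp only [f, signed_abs] at this
      exact Fin.ext (by omega)
    have hs : ∀ i, s i = s' i := by
      intro i
      have := congrFun h i
      simp only [f, he i] at this
      cases h1 : s i <;> cases h2 : s' i <;> simp [h1, h2] at this ⊢ <;> omega
    exact Prod.ext (funext hs) (Function.Embedding.ext he)
  have himage : ((intBox n m).filter fun z => ∀ W ∈ coxeterB n, (fun i => (z i : ℝ)) ∉ W) =
      Finset.univ.image f := by
    ext z
    simp only [Finset.mem_filter, hiff, mem_intBox, Finset.mem_image, Finset.mem_univ, true_and]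
    constructor
    · rintro ⟨hm, h0, hinj⟩
      have hpos : ∀ i, 0 < |z i| := fun i => abs_pos.2 (h0 i)
      refine ⟨(fun i => decide (0 < z i), ⟨fun i => ⟨(|z i| - 1).toNat, ?_⟩, ?_⟩), funext fun i => ?_⟩
      · have := hm i; have := hpos i; omega
      · intro i j hij
        have := Fin.mk.inj hij
        have := hpos i; have := hpos j
        exact hinj (by simp only; omega)
      · have h1 := hpos i
        change (if decide (0 < z i) = true then 1 else -1) * (((|z i| - 1).toNat : ℤ) + 1) = z i
        rw [Int.toNat_of_nonneg (by omega)]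
        simp only [decide_eq_true_eq]
        split_ifs with hi
        · rw [abs_of_pos hi]; ring
        · rw [abs_of_nonpos (not_lt.1 hi)]; ring
    · rintro ⟨⟨s, e⟩, rfl⟩
      have habs : ∀ i, |f (s, e) i| = ((e i : ℕ) : ℤ) + 1 := fun i => signed_abs _
      refine ⟨fun i => ?_, fun i hi => ?_, fun i j hij => ?_⟩
      · rw [habs]; have := (e i).2; omega
      · have := habs i; rw [hi, abs_zero] at this; omega
      · simp only [habs] at hij
        exact e.injective (Fin.ext (by omega))
  rw [himage, Finset.card_image_of_injective _ hf, Finset.card_univ, Fintype.card_prod,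
    Fintype.card_fun, Fintype.card_bool, Fintype.card_fin, Fintype.card_embedding_eq,
    Fintype.card_fin, Fintype.card_fin]

theorem prod_odd_shift (m : ℕ) : ∀ n ≤ m,
    ∏ k ∈ Finset.Icc 1 n, ((2 * m + 1 : ℤ) - (2 * (k : ℤ) - 1)) = 2 ^ n * (m.descFactorial n : ℤ) := by
  intro n
  induction n with
  | zero => simp
  | succ n ih =>
    intro hn
    rw [Finset.prod_Icc_succ_top (by omega), ih (by omega), Nat.descFactorial_succ]
    push_cast [Nat.cast_sub (show n ≤ m by omega)]
    ring

theorem arrangementCharPoly_coxeterB (p : Fin n → ℝ) :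
    arrangementCharPoly ((fun W => AffineSubspace.mk' p W) '' coxeterB n) =
      ∏ k ∈ Finset.Icc 1 n, (X - C (2 * (k : ℤ) - 1)) := by
  classical
  have hfin := coxeterB_finite.image fun W : Submodule ℝ (Fin n → ℝ) => AffineSubspace.mk' p W
  have htop : ⊤ ∉ (fun W => AffineSubspace.mk' p W) '' coxeterB n := by
    rintro ⟨W, hW, h⟩
    have h : AffineSubspace.mk' p W = ⊤ := h
    have h1 := congrArg AffineSubspace.direction h
    rw [AffineSubspace.direction_mk', AffineSubspace.direction_top] at h1
    exact top_notMem_coxeterB (h1 ▸ hW)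
  let emb : (Fin n → ℤ) ↪ (Fin n → ℝ) := ⟨fun z => (fun i => (z i : ℝ)) + p, fun z z' h => by
    have h := add_right_cancel h
    funext i
    exact_mod_cast congrFun h i⟩
  have hemb : ∀ z (W : Submodule ℝ (Fin n → ℝ)),
      emb z ∈ AffineSubspace.mk' p W ↔ (fun i => (z i : ℝ)) ∈ W := by
    intro z W
    rw [AffineSubspace.mem_mk']
    change (fun i => (z i : ℝ)) + p - p ∈ W ↔ _
    rw [add_sub_cancel_right]
  apply Polynomial.eq_of_infinite_eval_eq
  -- Both sides are compared at the odd numbers `2(m + n) + 1`; the shift by `n` supplies the bound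
  -- required by `prod_odd_shift`. The box is translated by `p` to match the arrangement.
  refine Set.infinite_of_injective_forall_mem (f := fun m : ℕ => (2 * ((m + n : ℕ) : ℤ) + 1))
    (fun a b h => by simp only at h; omega) fun m => ?_
  rw [Set.mem_ofPred_eq, eval_arrangementCharPoly hfin htop ((intBox n (m + n)).map emb), eval_prod]
  · simp only [eval_sub, eval_X, eval_C]
    rw [prod_odd_shift (m + n) n (by omega), Finset.filter_map, Finset.card_map]
    have := card_intBox_off_coxeterB (n := n) (m + n)
    simp only [Function.comp_def, Set.forall_mem_image, hemb]
    rw [this]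
    push_cast
    ring
  · rintro Y ⟨-, B, hB, rfl⟩
    obtain ⟨V, J, hV, h⟩ := exists_isSignedBasis_of_subset hB
    rw [h, AffineSubspace.direction_mk', hV.finrank_eq, Finset.filter_map, Finset.card_map]
    simp only [Function.comp_def, hemb]
    rw [hV.card_intBox]
    push_cast
    ring

end CoxeterB

theorem mainTheorem5 :
    -- (a)
    (∀ n : ℕ, 1 ≤ n →
      validOrderArrangement (visArrangement (stdCube n)) (cubeCenter n) =
          (fun W => AffineSubspace.mk' (cubeCenter n) W) '' coxeterB n ∧
      arrangementCharPoly (validOrderArrangement (visArrangement (stdCube n)) (cubeCenter n)) =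
          ∏ k ∈ Finset.Icc 1 n, (X - C (2 * (k : ℤ) - 1)) ∧
      (lineShellingsThrough (stdCube n) (cubeCenter n)).ncard = 2 ^ n * n !) ∧
    -- (b)
    (∀ n : ℕ, 1 ≤ n → (lineShellings (stdCube n)).ncard = 2 ^ n * (n !) ^ 2) ∧
    -- (c)
    (PowerSeries.mk (fun n : ℕ => if n = 0 then (0 : ℚ) else (numCubeShellings n : ℚ) / (n ! : ℚ)) =
      1 - (PowerSeries.mk (fun n : ℕ => ((2 * n)! : ℚ) / (n ! : ℚ)))⁻¹) ∧
    -- (d)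
    (∀ n : ℕ, 1 ≤ n → ∀ L ∈ shellings (stdCube n),
      ∃ Q : Set (Fin n → ℝ), IsPolytope Q ∧
        ∃ e : Face (stdCube n) ≃o Face Q, ∃ L' ∈ lineShellings Q, Corresponds e L L') := by
  refine ⟨fun n _ => ⟨validOrderArrangement_stdCube, ?_, ncard_lineShellingsThrough_cubeCenter n⟩,
    fun n _ => ncard_lineShellings_stdCube n, cubeShellings_generatingFunction,
    fun n hn L hL => cube_shelling_realizable hn hL⟩
  rw [validOrderArrangement_stdCube, arrangementCharPoly_coxeterB]
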